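/- Let $N\ge 1$, and let $\eta,\delta,\zeta,\bar\delta,\bar\zeta,\tau,\bar\tau,\xi_1,\dots,\xi_N\in\mathbb C$. Let $\mathcal H=(\mathbb C^2)^{\otimes N}$ and let $V_0=\mathbb C^2$ be an auxiliary space. Let $\sigma^z_j$ act on the $j$-th factor of $\mathcal H$, and let $|0\rangle\in\mathcal H$ be the vector with all spins up. In the basis $(++,+-,-+,--)$ of $\mathbb C^2\otimes\mathbb C^2$ put $$\mathcal R(\lambda;\theta)=\begin{pmatrix}\sinh(\lambda+\eta)&0&0&0\\0&\frac{\sinh\lambda\,\sinh(\theta-\eta)}{\sinh\theta}&\frac{\sinh\eta\,\sinh(\theta-\lambda)}{\sinh\theta}&0\\0&\frac{\sinh\eta\,\sinh(\theta+\lambda)}{\sinh\theta}&\frac{\sinh\lambda\,\sinh(\theta+\eta)}{\sinh\theta}&0\\0&0&0&\sinh(\lambda+\eta)\end{pmatrix},\qquad \mathcal K_-(\lambda;\delta,\zeta)=\begin{pmatrix}\frac{\sinh(\delta-\lambda)}{\sinh(\delta+\lambda)}&0\\0&\frac{\sinh(\zeta-\lambda)}{\sinh(\zeta+\lambda)}\end{pmatrix}.$$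 With $\theta_j=\theta-\eta\sum_{i=j+1}^N\sigma_i^z$ let $$\mathcal U_-(\lambda;\theta)=\mathcal R_{01}(\lambda-\xi_1;\theta_1)\cdots\mathcal R_{0N}(\lambda-\xi_N;\theta_N)\,\mathcal K_-(\lambda;\delta,\zeta)_0\,\mathcal R_{N0}(\lambda+\xi_N;\theta_N)\cdots\mathcal R_{10}(\lambda+\xi_1;\theta_1)=\begin{pmatrix}\mathcal A_-&\mathcal B_-\\ \mathcal C_-&\mathcal D_-\end{pmatrix}_{[0]}(\lambda;\theta),$$ $$\widetilde{\mathcal K}_+(\mu)=\frac{\sinh(\bar\delta-\bar\zeta-\eta\sigma^z)}{\sinh(\bar\delta-\bar\zeta)}\,\mathcal K_-(-\mu-\eta;\bar\delta,\bar\zeta),\qquad \mathbf T_{\mathrm{SOS}_1}(\mu;\theta)=\mathrm{Tr}_0\big(\widetilde{\mathcal K}_+(\mu)_0\,\mathcal U_-(\mu;\theta)\big).$$ **Proposition.** Let $\theta=\delta-\zeta$, let $s$ be an integer of the same parity as $N$ with $|s|<N$, put $M=(N-s)/2$, and suppose that for some $n,m\in\mathbb Z$ $$\bar\tau=\tau+\eta+i\pi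 n,\qquad \bar\delta-\bar\zeta=\delta-\zeta-\eta s+2i\pi m .$$ Assume $\sinh(\theta-\eta k)\ne0$ for all integers $k$ with $|k|<N$ (so that all the matrices $\mathcal R$ above are defined). Let $\lambda_1,\dots,\lambda_M\in\mathbb C$ be such that $\sinh(\delta+\lambda_i)\sinh(\zeta+\lambda_i)\neq0$ for all $i$, $\sinh(\lambda_i-\lambda_k)\ne0$ for all $i\ne k$, and $\sinh(\lambda_i+\lambda_k+\eta)\neq0$ for all $i,k$ (including $i=k$). Suppose that they satisfy the Bethe equations $$y_1(\lambda_i)=y_1(-\lambda_i-\eta),\qquad i=1,\dots,M,$$ where, for each $i$ (with the index $i$ and the other roots kept fixed on both sides), $$y_1(x)=\sinh(\zeta+x)\sinh(\delta-x)\sinh(\bar\zeta-x)\sinh(\bar\delta+x)\prod_{k\ne i}\sinh(x+\lambda_k)\sinh(x-\lambda_k-\eta)\prod_{j=1}^N\sinh(x+\xi_j+\eta)\sinh(x-\xi_j+\eta).$$ Then $\psi=\mathcal B_-(\lambda_1;\theta)\cdots\mathcal B_-(\lambda_M;\theta)|0\rangle$ satisfies $$\mathbf T_{\mathrm{SOS}_1}(\mu;\theta)\,\psi=\Lambda_1(\mu)\,\psi,$$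 and so is an eigenvector with eigenvalue $\Lambda_1(\mu)$ whenever $\psi\neq0$, for every $\mu\in\mathbb C$ such that none of $\sinh(\delta+\mu)$, $\sinh(\zeta+\mu)$, $\sinh(\bar\delta-\mu-\eta)$, $\sinh(\bar\zeta-\mu-\eta)$, $\sinh(2\mu+\eta)$, $\sinh(\mu-\lambda_i)$, $\sinh(\mu+\lambda_i+\eta)$ vanishes. Here $$\begin{aligned}\Lambda_1(\mu)={}&\frac{\sinh(\bar\zeta-\mu)\sinh(\bar\delta+\mu)\sinh(\delta-\mu)\sinh(2\mu+2\eta)}{\sinh(\bar\zeta-\mu-\eta)\sinh(\bar\delta-\mu-\eta)\sinh(\delta+\mu)\sinh(2\mu+\eta)}\prod_{i=1}^M\frac{\sinh(\mu+\lambda_i)\sinh(\mu-\lambda_i-\eta)}{\sinh(\mu+\lambda_i+\eta)\sinh(\mu-\lambda_i)}\prod_{j=1}^N\sinh(\mu+\xi_j+\eta)\sinh(\mu-\xi_j+\eta)\\&+\frac{\sinh(\bar\zeta+\mu+\eta)\sinh(\delta+\mu+\eta)\sinh(\zeta-\mu-\eta)\sinh(2\mu)}{\sinh(\bar\zeta-\mu-\eta)\sinh(\delta+\mu)\sinh(\zeta+\mu)\sinh(2\mu+\eta)}\prod_{i=1}^M\frac{\sinh(\mu+\lambda_i+2\eta)\sinh(\mu-\lambda_i+\eta)}{\sinh(\mu+\lambda_i+\eta)\sinh(\mu-\lambda_i)}\prod_{j=1}^N\sinh(\mu+\xi_j)\sinh(\mu-\xi_j).\end{aligned}$$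 -/

import Mathlib

open Complex Matrix

noncomputable section

namespace SOS

/-- Eigenvalues of `σᶻ`: the basis vector `0` of `ℂ²` is "up" (`+1`), the vector `1` is "down"
(`-1`). -/
def sz (a : Fin 2) : ℂ := if a = 0 then 1 else -1

/-- Spin configurations of the chain.  They index the standard basis of `(ℂ²)^{⊗ N}`, so vectors of
the quantum space are functions `Config N → ℂ` and operators are matrices indexed by `Config N`. -/
abbrev Config (N : ℕ) := Fin N → Fin 2

/-- Operators on the quantum space `(ℂ²)^{⊗ N}`. -/
abbrev Op (N : ℕ) := Matrix (Config N) (Config N) ℂ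

/-- Operators on `V₀ ⊗ (ℂ²)^{⊗ N}`, where `V₀ = ℂ²` is the auxiliary space. -/
abbrev AuxOp (N : ℕ) := Matrix (Fin 2 × Config N) (Fin 2 × Config N) ℂ

/-- The trigonometric dynamical `R`-matrix `R(u; θ)` on `ℂ² ⊗ ℂ²`. -/
def dynR (η u θ : ℂ) : Matrix (Fin 2 × Fin 2) (Fin 2 × Fin 2) ℂ :=
  Matrix.submatrix (m := Fin 4) (n := Fin 4)
    !![sinh (u + η), 0, 0, 0;
       0, sinh u * sinh (θ - η) / sinh θ, sinh η * sinh (θ - u) / sinh θ, 0;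
       0, sinh η * sinh (θ + u) / sinh θ, sinh u * sinh (θ + η) / sinh θ, 0;
       0, 0, 0, sinh (u + η)]
    finProdFinEquiv finProdFinEquiv

/-- The dynamical parameter `θ - η ∑_{j > m} σᶻ_j` seen at site `m`, on a basis vector. -/
def siteParam {N : ℕ} (η θ : ℂ) (m : Fin N) (t : Config N) : ℂ :=
  θ - η * ∑ j ∈ Finset.Ioi m, sz (t j)

/-- `R_{0m}(u; θ - η ∑_{j > m} σᶻ_j)`. -/
def siteR {N : ℕ} (η θ : ℂ) (m : Fin N) (u : ℂ) : AuxOp N :=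
  Matrix.of fun p q =>
    if ∀ j, j ≠ m → p.2 j = q.2 j then
      dynR η u (siteParam η θ m q.2) (p.1, p.2 m) (q.1, q.2 m)
    else 0

/-- `R_{m0}(u; θ - η ∑_{j > m} σᶻ_j)`: the first tensor factor of `R` is now site `m`. -/
def siteRhat {N : ℕ} (η θ : ℂ) (m : Fin N) (u : ℂ) : AuxOp N :=
  Matrix.of fun p q =>
    if ∀ j, j ≠ m → p.2 j = q.2 j then
      dynR η u (siteParam η θ m q.2) (p.2 m, p.1) (q.2 m, q.1)
    else 0

/-- The dynamical monodromy matrix `R_{01}(u - ξ₁; ·) ⋯ R_{0N}(u - ξ_N; ·)`. -/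
def monodromy {N : ℕ} (η θ : ℂ) (ξ : Fin N → ℂ) (u : ℂ) : AuxOp N :=
  (List.ofFn fun m => siteR η θ m (u - ξ m)).prod

/-- The reversed monodromy matrix `R_{N0}(u + ξ_N; ·) ⋯ R_{10}(u + ξ₁; ·)`. -/
def monodromyHat {N : ℕ} (η θ : ℂ) (ξ : Fin N → ℂ) (u : ℂ) : AuxOp N :=
  (List.ofFn fun m => siteRhat η θ m (u + ξ m)).reverse.prod

/-- The diagonal boundary matrix `K₋(u; δ, ζ)`. -/
def Kminus (δ ζ u : ℂ) : Matrix (Fin 2) (Fin 2) ℂ :=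
  Matrix.diagonal ![sinh (δ - u) / sinh (δ + u), sinh (ζ - u) / sinh (ζ + u)]

/-- The boundary matrix
`sinh(δ' - ζ' - η σᶻ) / sinh(δ' - ζ') * K₋(-u - η; δ', ζ')`. -/
def KplusTilde (η δ' ζ' u : ℂ) : Matrix (Fin 2) (Fin 2) ℂ :=
  Matrix.diagonal (fun a => sinh (δ' - ζ' - η * sz a) / sinh (δ' - ζ'))
    * Kminus δ' ζ' (-u - η)

/-- A `2 × 2` matrix acting on the auxiliary space only. -/
def onAux {N : ℕ} (K : Matrix (Fin 2) (Fin 2) ℂ) : AuxOp N :=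
  Matrix.kroneckerMap (· * ·) K (1 : Op N)

/-- The `(a, b)` entry of an operator on `V₀ ⊗ (ℂ²)^{⊗ N}`, seen as a `2 × 2` matrix with entries
in the operators on `(ℂ²)^{⊗ N}`. -/
def entry {N : ℕ} (X : AuxOp N) (a b : Fin 2) : Op N :=
  Matrix.of fun s t => X (a, s) (b, t)

/-- The partial trace over the auxiliary space. -/
def traceAux {N : ℕ} (X : AuxOp N) : Op N := ∑ a, entry X a a

/-- The dynamical double row monodromy matrix `U₋(u; θ)`. -/
def doubleRow {N : ℕ} (η θ δ ζ : ℂ) (ξ : Fin N → ℂ) (u : ℂ) : AuxOp N :=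
  monodromy η θ ξ u * onAux (Kminus δ ζ u) * monodromyHat η θ ξ u

/-- The creation operator `B₋(u; θ)`, the upper right entry of `U₋(u; θ)`. -/
def Bminus {N : ℕ} (η θ δ ζ : ℂ) (ξ : Fin N → ℂ) (u : ℂ) : Op N :=
  entry (doubleRow η θ δ ζ ξ u) 0 1

/-- The SOS transfer matrix `Tr₀ (K̃₊(u; δ', ζ') U₋(u; θ))`. -/
def transferSOS {N : ℕ} (η θ δ ζ δ' ζ' : ℂ) (ξ : Fin N → ℂ) (u : ℂ) : Op N :=
  traceAux (onAux (KplusTilde η δ' ζ' u) * doubleRow η θ δ ζ ξ u)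

/-- The reference state with all spins up. -/
def refState (N : ℕ) : Config N → ℂ := Pi.single (fun _ => 0) 1

/-- The Bethe state `B₋(v₁; θ) ⋯ B₋(v_M; θ) |0⟩`. -/
def betheState {N M : ℕ} (η θ δ ζ : ℂ) (ξ : Fin N → ℂ) (v : Fin M → ℂ) : Config N → ℂ :=
  (List.ofFn fun i => Bminus η θ δ ζ ξ (v i)).prod *ᵥ refState N

/-- The eigenvalue `Λ₁(u; {v}; δ, ζ, δ', ζ')`. -/
def Lambda1 {N M : ℕ} (η δ ζ δ' ζ' : ℂ) (ξ : Fin N → ℂ) (v : Fin M → ℂ) (u : ℂ) : ℂ :=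
  (sinh (ζ' - u) * sinh (δ' + u) * sinh (δ - u) * sinh (2 * u + 2 * η))
      / (sinh (ζ' - u - η) * sinh (δ' - u - η) * sinh (δ + u) * sinh (2 * u + η))
    * (∏ i, (sinh (u + v i) * sinh (u - v i - η)) / (sinh (u + v i + η) * sinh (u - v i)))
    * (∏ j, sinh (u + ξ j + η) * sinh (u - ξ j + η))
  + (sinh (ζ' + u + η) * sinh (δ + u + η) * sinh (ζ - u - η) * sinh (2 * u))
      / (sinh (ζ' - u - η) * sinh (δ + u) * sinh (ζ + u) * sinh (2 * u + η))
    * (∏ i, (sinh (u + v i + 2 * η) * sinh (u - v i + η))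
        / (sinh (u + v i + η) * sinh (u - v i)))
    * (∏ j, sinh (u + ξ j) * sinh (u - ξ j))

/-- The function `y₁(x, {v}; δ, ζ, δ', ζ')` attached to the `i`-th Bethe root; it is to be
evaluated at `x = v i` and at `x = -v i - η`, the other roots being unchanged. -/
def y1 {N M : ℕ} (η δ ζ δ' ζ' : ℂ) (ξ : Fin N → ℂ) (v : Fin M → ℂ) (i : Fin M) (x : ℂ) : ℂ :=
  sinh (ζ + x) * sinh (δ - x) * sinh (ζ' - x) * sinh (δ' + x)
    * (∏ k ∈ Finset.univ.erase i, sinh (x + v k) * sinh (x - v k - η))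
    * (∏ j, sinh (x + ξ j + η) * sinh (x - ξ j + η))

end SOS

end

open Complex Matrix

noncomputable section

namespace SOS

/-! This is the algebraic Bethe ansatz for the dynamical reflection algebra. The diagonal `K₋`
satisfies the dynamical reflection equation when `θ = δ - ζ` (`reflection_Kminus`). Adding a site at
the left end of the chain preserves that equation, by the dynamical Yang-Baxter equation and
conservation of total spin (`Reflection.dress`), so the whole double row operator satisfies it
(`reflection_doubleRow`). On vectors of total spin `k` the operator-valued dynamical parameter is
the number `θ - η k`, so blocks of the reflection equation become exchange relations with scalar
coefficients.

The operator `D₋` is replaced by its combination `companion` with `A₋`, written `E`. Moving `E(u)`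
past `B(v)` produces no `B(v) A(u)` term, and `E` has a product eigenvalue on the reference state.
Hence `A` and `E` each act on a Bethe vector by a product eigenvalue plus unwanted terms, in each of
which one root is replaced by `u`. The unwanted coefficients are found by induction on the set of
roots (`offShell`): the coefficient of the newest root is read off directly, and those of the older
roots propagate by the four `_cocycle` identities.

The boundary constraint makes `δ' - ζ'` equal, modulo `2πi`, to the dynamical parameter on the Bethe
state. The transfer matrix is then a combination of `A` and `E` in which every unwanted coefficient
is a common factor times `y₁(λᵢ) - y₁(-λᵢ - η)` (`transferSOS_offShell`), and the Bethe equations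
make it vanish.

The off-shell formula requires many more factors `sinh` to be nonzero than the theorem assumes. All
parameters are therefore perturbed along a line on which the extra conditions hold near, but not at,
the point of interest; the identity is then passed to the limit. Since the Bethe equations need not
survive the perturbation, the off-shell formula is what is continued, and the equations are imposed
only in the limit. -/

/-! ### The weights of the R-matrix and the Yang-Baxter equation on three spins. -/

/-- The diagonal weights of the dynamical `R`-matrix. -/
def wDiag (η u t : ℂ) (a b : Fin 2) : ℂ :=
  if a = b then sinh (u + η) else sinh u * sinh (t - η * sz a) / sinh t

/-- The off-diagonal (exchange) weights of the dynamical `R`-matrix. -/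
def wSwap (η u t : ℂ) (a b : Fin 2) : ℂ :=
  if a = b then 0 else sinh η * sinh (t - u * sz a) / sinh t

/-- The ice rule: a basis pair is mapped only to itself and to its exchange. Hence R is a
multiplication operator plus a weighted permutation. -/
theorem dynR_apply (η u t : ℂ) (a b c d : Fin 2) :
    dynR η u t (a, b) (c, d) =
      (if a = c ∧ b = d then wDiag η u t a b else 0)
        + (if a = d ∧ b = c then wSwap η u t a b else 0) := by
  fin_cases a <;> fin_cases b <;> fin_cases c <;> fin_cases d <;>
    simp [dynR, wDiag, wSwap, sz, finProdFinEquiv]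

/-- `R₁₂(x; ·)` acting on functions of three spins. -/
def act12 (η x : ℂ) (t : Fin 2 → ℂ) (f : Fin 2 → Fin 2 → Fin 2 → ℂ) (a b c : Fin 2) : ℂ :=
  wDiag η x (t c) a b * f a b c + wSwap η x (t c) a b * f b a c

/-- `R₁₃(x; ·)` acting on functions of three spins. -/
def act13 (η x : ℂ) (t : Fin 2 → ℂ) (f : Fin 2 → Fin 2 → Fin 2 → ℂ) (a b c : Fin 2) : ℂ :=
  wDiag η x (t b) a c * f a b c + wSwap η x (t b) a c * f c b a

/-- `R₂₃(x; ·)` acting on functions of three spins. -/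
def act23 (η x : ℂ) (t : Fin 2 → ℂ) (f : Fin 2 → Fin 2 → Fin 2 → ℂ) (a b c : Fin 2) : ℂ :=
  wDiag η x (t a) b c * f a b c + wSwap η x (t a) b c * f a c b

/-- `R₂₁(x; ·)` acting on functions of three spins. -/
def act21 (η x : ℂ) (t : Fin 2 → ℂ) (f : Fin 2 → Fin 2 → Fin 2 → ℂ) (a b c : Fin 2) : ℂ :=
  wDiag η x (t c) b a * f a b c + wSwap η x (t c) b a * f b a c

/-- `R₃₁(x; ·)` acting on functions of three spins. -/
def act31 (η x : ℂ) (t : Fin 2 → ℂ) (f : Fin 2 → Fin 2 → Fin 2 → ℂ) (a b c : Fin 2) : ℂ :=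
  wDiag η x (t b) c a * f a b c + wSwap η x (t b) c a * f c b a

variable {η t : ℂ}

/-- The dynamical Yang-Baxter equation. -/
theorem dynamical_yangBaxter (x y : ℂ) (h0 : sinh t ≠ 0) (h1 : sinh (t - η) ≠ 0)
    (h2 : sinh (t + η) ≠ 0) (f : Fin 2 → Fin 2 → Fin 2 → ℂ) (a b c : Fin 2) :
    act12 η (x - y) (fun d => t - η * sz d) (act13 η x (fun _ => t)
        (act23 η y (fun d => t - η * sz d) f)) a b c =
      act23 η y (fun _ => t) (act13 η x (fun d => t - η * sz d)
        (act12 η (x - y) (fun _ => t) f)) a b c := by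
  fin_cases a <;> fin_cases b <;> fin_cases c <;>
    simp [act12, act13, act23, wDiag, wSwap, sz]
  all_goals field_simp
  -- With denominators cleared, each component is a Laurent polynomial identity in the exponentials
  -- of the parameters.
  all_goals
    simp only [Complex.sinh, neg_add, sub_eq_add_neg, Complex.exp_add, Complex.exp_neg, neg_neg]
    field_simp [Complex.exp_ne_zero]
    ring

/-- The "crossed" form of the dynamical Yang-Baxter equation, with `R₃₁ R₂₁ R₂₃`. -/
theorem dynamical_yangBaxter_crossed (x y : ℂ) (h0 : sinh t ≠ 0) (h1 : sinh (t - η) ≠ 0)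
    (h2 : sinh (t + η) ≠ 0) (f : Fin 2 → Fin 2 → Fin 2 → ℂ) (a b c : Fin 2) :
    act31 η x (fun _ => t) (act21 η (x + y) (fun d => t - η * sz d)
        (act23 η y (fun _ => t) f)) a b c =
      act23 η y (fun d => t - η * sz d) (act21 η (x + y) (fun _ => t)
        (act31 η x (fun d => t - η * sz d) f)) a b c := by
  fin_cases a <;> fin_cases b <;> fin_cases c <;>
    simp [act21, act31, act23, wDiag, wSwap, sz]
  all_goals field_simp
  all_goals
    simp only [Complex.sinh, neg_add, sub_eq_add_neg, Complex.exp_add, Complex.exp_neg, neg_neg]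
    field_simp [Complex.exp_ne_zero]
    ring

/-! ### Weighted permutation operators and tensoring with an identity. -/

section MixOp

variable {X : Type*} [DecidableEq X]

/-- The matrix which multiplies by `w` and adds `v` times the pull-back along `σ`. -/
def mixOp (w v : X → ℂ) (σ : X → X) : Matrix X X ℂ :=
  Matrix.of fun p q => (if p = q then w p else 0) + (if σ p = q then v p else 0)

theorem mixOp_mulVec [Fintype X] (w v : X → ℂ) (σ : X → X) (f : X → ℂ) (p : X) :
    (mixOp w v σ *ᵥ f) p = w p * f p + v p * f (σ p) := by
  simp [mixOp, Matrix.mulVec, dotProduct, add_mul, Finset.sum_add_distrib, ite_mul]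

theorem matrix_ext_mulVec {X : Type*} [Fintype X] {A B : Matrix X X ℂ} (h : ∀ f, A *ᵥ f = B *ᵥ f) : A = B :=
  Matrix.mulVec_injective (funext h)

/-- The matrix `M` commutes with the pull-back along `σ` because it is `σ`-invariant, and with
multiplication by `w` and `v` because these are constant along its nonzero entries. -/
theorem commute_mixOp [Fintype X] {w v : X → ℂ} {σ : X → X} (hσ : ∀ p, σ (σ p) = p)
    {M : Matrix X X ℂ} (hM : ∀ p q, M (σ p) (σ q) = M p q)
    (hw : ∀ p q, M p q ≠ 0 → w p = w q) (hv : ∀ p q, M p q ≠ 0 → v p = v q) :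
    M * mixOp w v σ = mixOp w v σ * M := by
  have hσ' : ∀ p q, σ p = q ↔ p = σ q := fun p q =>
    ⟨fun h => by rw [← h, hσ], fun h => by rw [h, hσ]⟩
  have hvσ : ∀ p q, M p (σ q) ≠ 0 → v p = v (σ q) := fun p q => hv _ _
  ext p q
  simp only [Matrix.mul_apply, mixOp, Matrix.of_apply, mul_add, add_mul, Finset.sum_add_distrib,
    ite_mul, mul_ite, mul_zero, zero_mul, hσ', Finset.sum_ite_eq, Finset.sum_ite_eq',
    Finset.mem_univ, if_true]
  congr 1
  · by_cases h : M p q = 0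
    · simp [h]
    · rw [hw p q h, mul_comm]
  · have e : ∀ x, (p = σ x) = (σ p = x) := fun x => by rw [hσ']
    simp only [e, Finset.sum_ite_eq, Finset.mem_univ, if_true]
    have h2 : M (σ p) q = M p (σ q) := by rw [← hM p (σ q), hσ]
    rw [h2]
    by_cases h : M p (σ q) = 0
    · simp [h]
    · rw [hvσ p q h, mul_comm]

end MixOp

section Amplify

variable {α β γ : Type*} [Fintype α] [Fintype β] [Fintype γ] [DecidableEq γ]

/-- Amplification of a matrix along a splitting of its index type. -/
def amp (e : α ≃ β × γ) (M : Matrix β β ℂ) : Matrix α α ℂ :=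
  Matrix.of fun p q => if (e p).2 = (e q).2 then M (e p).1 (e q).1 else 0

theorem amp_mul (e : α ≃ β × γ) (M N : Matrix β β ℂ) : amp e (M * N) = amp e M * amp e N := by
  ext p q
  simp only [amp, Matrix.of_apply, Matrix.mul_apply]
  rw [← e.symm.sum_comp, Fintype.sum_prod_type]
  simp [ite_mul, mul_ite]

/-- `α × β × γ ≃ (α × γ) × β`. -/
def splitFst (α β γ : Type*) : α × β × γ ≃ (α × γ) × β where
  toFun p := ((p.1, p.2.2), p.2.1)
  invFun p := (p.1.1, p.2, p.1.2)

/-- `α × β × γ ≃ (β × γ) × α`. -/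
def splitSnd (α β γ : Type*) : α × β × γ ≃ (β × γ) × α := Equiv.prodComm _ _

/-- `α × α × α × γ ≃ (α × α × γ) × α`, splitting off the third factor. -/
def splitThird (α γ : Type*) : α × α × α × γ ≃ (α × α × γ) × α where
  toFun p := ((p.1, p.2.1, p.2.2.2), p.2.2.1)
  invFun p := (p.1.1, p.1.2.1, p.2, p.1.2.2)

end Amplify

/-! ### The dynamical reflection equation and its dressing by one site. -/

variable {ι : Type*} [Fintype ι] [DecidableEq ι]

/-- `R₁₂(u; T)` on `ℂ² ⊗ ℂ² ⊗ ℂ^ι`. -/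
def rop (η : ℂ) (T : ι → ℂ) (u : ℂ) : Matrix (Fin 2 × Fin 2 × ι) (Fin 2 × Fin 2 × ι) ℂ :=
  mixOp (fun p => wDiag η u (T p.2.2) p.1 p.2.1) (fun p => wSwap η u (T p.2.2) p.1 p.2.1)
    (fun p => (p.2.1, p.1, p.2.2))

/-- `R₂₁(u; T)` on `ℂ² ⊗ ℂ² ⊗ ℂ^ι`. -/
def ropHat (η : ℂ) (T : ι → ℂ) (u : ℂ) : Matrix (Fin 2 × Fin 2 × ι) (Fin 2 × Fin 2 × ι) ℂ :=
  mixOp (fun p => wDiag η u (T p.2.2) p.2.1 p.1) (fun p => wSwap η u (T p.2.2) p.2.1 p.1)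
    (fun p => (p.2.1, p.1, p.2.2))

/-- An operator on `ℂ² ⊗ ℂ^ι` seen as one on the first and third factors of `ℂ² ⊗ ℂ² ⊗ ℂ^ι`. -/
def on1 (M : Matrix (Fin 2 × ι) (Fin 2 × ι) ℂ) :
    Matrix (Fin 2 × Fin 2 × ι) (Fin 2 × Fin 2 × ι) ℂ := amp (splitFst _ _ _) M

/-- An operator on `ℂ² ⊗ ℂ^ι` seen as one on the last two factors of `ℂ² ⊗ ℂ² ⊗ ℂ^ι`. -/
def on2 (M : Matrix (Fin 2 × ι) (Fin 2 × ι) ℂ) :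
    Matrix (Fin 2 × Fin 2 × ι) (Fin 2 × Fin 2 × ι) ℂ := amp (splitSnd _ _ _) M

/-- The dynamical reflection equation. -/
def Reflection (η : ℂ) (T : ι → ℂ) (u v : ℂ) (U V : Matrix (Fin 2 × ι) (Fin 2 × ι) ℂ) : Prop :=
  rop η T (u - v) * on1 U * ropHat η T (u + v) * on2 V =
    on2 V * rop η T (u + v) * on1 U * ropHat η T (u - v)

/-- The dynamical parameter after adding a site. -/
def addSite (η : ℂ) (T : ι → ℂ) (p : Fin 2 × ι) : ℂ := T p.2 - η * sz p.1

/-- Conservation of the dynamical parameter. -/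
def Conserves (η : ℂ) (T : ι → ℂ) (U : Matrix (Fin 2 × ι) (Fin 2 × ι) ℂ) : Prop :=
  ∀ p q, U p q ≠ 0 → addSite η T p = addSite η T q

/-- Dressing of a double row operator by one more site. -/
def dress (η : ℂ) (T : ι → ℂ) (ξ u : ℂ) (U : Matrix (Fin 2 × ι) (Fin 2 × ι) ℂ) :
    Matrix (Fin 2 × Fin 2 × ι) (Fin 2 × Fin 2 × ι) ℂ :=
  rop η T (u - ξ) * on1 U * ropHat η T (u + ξ)

section Local

variable (η : ℂ) (T : ι → ℂ)

/-- `R₁₃(u; T - η σ₂)` on `ℂ² ⊗ ℂ² ⊗ ℂ² ⊗ ℂ^ι`. -/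
def shift13 (u : ℂ) : Matrix (Fin 2 × Fin 2 × Fin 2 × ι) (Fin 2 × Fin 2 × Fin 2 × ι) ℂ :=
  mixOp (fun p => wDiag η u (T p.2.2.2 - η * sz p.2.1) p.1 p.2.2.1)
    (fun p => wSwap η u (T p.2.2.2 - η * sz p.2.1) p.1 p.2.2.1)
    (fun p => (p.2.2.1, p.2.1, p.1, p.2.2.2))

/-- `R₃₁(u; T - η σ₂)` on `ℂ² ⊗ ℂ² ⊗ ℂ² ⊗ ℂ^ι`. -/
def shift31 (u : ℂ) : Matrix (Fin 2 × Fin 2 × Fin 2 × ι) (Fin 2 × Fin 2 × Fin 2 × ι) ℂ :=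
  mixOp (fun p => wDiag η u (T p.2.2.2 - η * sz p.2.1) p.2.2.1 p.1)
    (fun p => wSwap η u (T p.2.2.2 - η * sz p.2.1) p.2.2.1 p.1)
    (fun p => (p.2.2.1, p.2.1, p.1, p.2.2.2))

/-- `R₂₃(u; T - η σ₁)` on `ℂ² ⊗ ℂ² ⊗ ℂ² ⊗ ℂ^ι`. -/
def shift23 (u : ℂ) : Matrix (Fin 2 × Fin 2 × Fin 2 × ι) (Fin 2 × Fin 2 × Fin 2 × ι) ℂ :=
  mixOp (fun p => wDiag η u (T p.2.2.2 - η * sz p.1) p.2.1 p.2.2.1)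
    (fun p => wSwap η u (T p.2.2.2 - η * sz p.1) p.2.1 p.2.2.1)
    (fun p => (p.1, p.2.2.1, p.2.1, p.2.2.2))

/-- `R₃₂(u; T - η σ₁)` on `ℂ² ⊗ ℂ² ⊗ ℂ² ⊗ ℂ^ι`. -/
def shift32 (u : ℂ) : Matrix (Fin 2 × Fin 2 × Fin 2 × ι) (Fin 2 × Fin 2 × Fin 2 × ι) ℂ :=
  mixOp (fun p => wDiag η u (T p.2.2.2 - η * sz p.1) p.2.2.1 p.2.1)
    (fun p => wSwap η u (T p.2.2.2 - η * sz p.1) p.2.2.1 p.2.1)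
    (fun p => (p.1, p.2.2.1, p.2.1, p.2.2.2))

theorem on1_mul (M N : Matrix (Fin 2 × ι) (Fin 2 × ι) ℂ) : on1 (M * N) = on1 M * on1 N :=
  amp_mul _ _ _

theorem on2_mul (M N : Matrix (Fin 2 × ι) (Fin 2 × ι) ℂ) : on2 (M * N) = on2 M * on2 N :=
  amp_mul _ _ _

/-- The amplified operator is again a weighted permutation, so products of R-operators can be
evaluated one component at a time. -/
theorem amp_mixOp_mulVec {α β γ : Type*} [Fintype α] [Fintype β] [DecidableEq α]
    [DecidableEq β] [DecidableEq γ] [Fintype γ] (e : α ≃ β × γ) (w v : β → ℂ) (σ : β → β)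
    (f : α → ℂ) (p : α) :
    (amp e (mixOp w v σ) *ᵥ f) p =
      w (e p).1 * f p + v (e p).1 * f (e.symm (σ (e p).1, (e p).2)) := by
  have : amp e (mixOp w v σ) = mixOp (fun p => w (e p).1) (fun p => v (e p).1)
      (fun p => e.symm (σ (e p).1, (e p).2)) := by
    ext p q
    simp only [amp, mixOp, Matrix.of_apply, Equiv.symm_apply_eq, Prod.ext_iff]
    by_cases h : (e p).2 = (e q).2
    · have : p = q ↔ (e p).1 = (e q).1 := by
        rw [← e.apply_eq_iff_eq, Prod.ext_iff]; simp [h]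
      simp [h, this]
    · have : p ≠ q := fun hh => h (by rw [hh])
      simp [h, this]
  rw [this, mixOp_mulVec]

/-- With the rest of the chain frozen at `s`, this and the three following relations are the
three-spin Yang-Baxter equations. The first two factors are auxiliary and the third is the new site;
the last two relations are read backwards with two of the three spaces interchanged. -/
theorem on1_ropHat_mul (hT : ∀ s, sinh (T s) ≠ 0) (hm : ∀ s, sinh (T s - η) ≠ 0)
    (hp : ∀ s, sinh (T s + η) ≠ 0) (x y : ℂ) :
    on1 (ropHat η T x) * ropHat η (addSite η T) (x + y) * on2 (rop η T y) =
      shift23 η T y * amp (splitThird _ _) (ropHat η T (x + y)) * shift31 η T x := by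
  refine matrix_ext_mulVec fun F => funext fun ⟨a, b, c, s⟩ => ?_
  simp only [← Matrix.mulVec_mulVec, on1, on2, ropHat, rop, shift23, shift31, amp_mixOp_mulVec,
    mixOp_mulVec]
  exact dynamical_yangBaxter_crossed x y (hT s) (hm s) (hp s)
      (fun a b c => F (a, b, c, s)) a b c

theorem rop_mul_on1 (hT : ∀ s, sinh (T s) ≠ 0) (hm : ∀ s, sinh (T s - η) ≠ 0)
    (hp : ∀ s, sinh (T s + η) ≠ 0) (x y : ℂ) :
    rop η (addSite η T) (x - y) * on1 (rop η T x) * shift23 η T y =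
      on2 (rop η T y) * shift13 η T x * amp (splitThird _ _) (rop η T (x - y)) := by
  refine matrix_ext_mulVec fun F => funext fun ⟨a, b, c, s⟩ => ?_
  simp only [← Matrix.mulVec_mulVec, on1, on2, rop, shift23, shift13, amp_mixOp_mulVec,
    mixOp_mulVec]
  exact dynamical_yangBaxter x y (hT s) (hm s) (hp s)
      (fun a b c => F (a, b, c, s)) a b c

theorem ropHat_mul_shift31 (hT : ∀ s, sinh (T s) ≠ 0) (hm : ∀ s, sinh (T s - η) ≠ 0)
    (hp : ∀ s, sinh (T s + η) ≠ 0) (x y : ℂ) :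
    amp (splitThird _ _) (ropHat η T y) * shift31 η T x * on2 (ropHat η T (x - y)) =
      shift32 η T (x - y) * on1 (ropHat η T x) * ropHat η (addSite η T) y := by
  refine matrix_ext_mulVec fun F => funext fun ⟨a, b, c, s⟩ => ?_
  simp only [← Matrix.mulVec_mulVec, on1, on2, ropHat, shift31, shift32, amp_mixOp_mulVec,
    mixOp_mulVec]
  exact (dynamical_yangBaxter x y (hT s) (hm s) (hp s)
      (fun a b c => F (c, b, a, s)) c b a).symm

theorem shift13_mul_rop (hT : ∀ s, sinh (T s) ≠ 0) (hm : ∀ s, sinh (T s - η) ≠ 0)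
    (hp : ∀ s, sinh (T s + η) ≠ 0) (x y : ℂ) :
    shift13 η T y * amp (splitThird _ _) (rop η T (x + y)) * shift32 η T x =
      on2 (ropHat η T x) * rop η (addSite η T) (x + y) * on1 (rop η T y) := by
  refine matrix_ext_mulVec fun F => funext fun ⟨a, b, c, s⟩ => ?_
  simp only [← Matrix.mulVec_mulVec, on1, on2, ropHat, rop, shift13, shift32, amp_mixOp_mulVec,
    mixOp_mulVec]
  exact (dynamical_yangBaxter_crossed x y (hT s) (hm s) (hp s)
      (fun a b c => F (b, a, c, s)) b a c).symm

end Local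

section Commute

variable {η : ℂ} {T : ι → ℂ} {U : Matrix (Fin 2 × ι) (Fin 2 × ι) ℂ}

theorem on1_on1_apply (p q : Fin 2 × Fin 2 × Fin 2 × ι) :
    on1 (on1 U) p q = if p.2.1 = q.2.1 ∧ p.2.2.1 = q.2.2.1 then
      U (p.1, p.2.2.2) (q.1, q.2.2.2) else 0 := by
  by_cases h1 : p.2.1 = q.2.1 <;> by_cases h2 : p.2.2.1 = q.2.2.1 <;>
    simp [on1, amp, splitFst, h1, h2]

theorem on2_on1_apply (p q : Fin 2 × Fin 2 × Fin 2 × ι) :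
    on2 (on1 U) p q = if p.1 = q.1 ∧ p.2.2.1 = q.2.2.1 then
      U (p.2.1, p.2.2.2) (q.2.1, q.2.2.2) else 0 := by
  by_cases h1 : p.1 = q.1 <;> by_cases h2 : p.2.2.1 = q.2.2.1 <;>
    simp [on1, on2, amp, splitFst, splitSnd, h1, h2]

/-- The two operators act on different spaces and interact only through the parameter `T - η σ₁` of
the R-matrix, which `U` conserves. The three analogous lemmas below hold for the same reason. -/
theorem on1_on1_commute_shift23 (hU : Conserves η T U) (x : ℂ) :
    on1 (on1 U) * shift23 η T x = shift23 η T x * on1 (on1 U) := by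
  refine commute_mixOp (fun p => rfl) (fun p q => ?_) (fun p q h => ?_) (fun p q h => ?_)
  · simp only [on1_on1_apply, and_comm]
  all_goals
    rw [on1_on1_apply] at h
    have h1 := (ite_ne_right_iff.1 h)
    have h2 := hU _ _ h1.2
    simp only [addSite] at h2
    simp only [h1.1.1, h1.1.2, h2]

theorem on1_on1_commute_shift32 (hU : Conserves η T U) (x : ℂ) :
    on1 (on1 U) * shift32 η T x = shift32 η T x * on1 (on1 U) := by
  refine commute_mixOp (fun p => rfl) (fun p q => ?_) (fun p q h => ?_) (fun p q h => ?_)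
  · simp only [on1_on1_apply, and_comm]
  all_goals
    rw [on1_on1_apply] at h
    have h1 := (ite_ne_right_iff.1 h)
    have h2 := hU _ _ h1.2
    simp only [addSite] at h2
    simp only [h1.1.1, h1.1.2, h2]

theorem on2_on1_commute_shift13 (hU : Conserves η T U) (x : ℂ) :
    on2 (on1 U) * shift13 η T x = shift13 η T x * on2 (on1 U) := by
  refine commute_mixOp (fun p => rfl) (fun p q => ?_) (fun p q h => ?_) (fun p q h => ?_)
  · simp only [on2_on1_apply, and_comm]
  all_goals
    rw [on2_on1_apply] at h
    have h1 := (ite_ne_right_iff.1 h)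
    have h2 := hU _ _ h1.2
    simp only [addSite] at h2
    simp only [h1.1.1, h1.1.2, h2]

theorem on2_on1_commute_shift31 (hU : Conserves η T U) (x : ℂ) :
    on2 (on1 U) * shift31 η T x = shift31 η T x * on2 (on1 U) := by
  refine commute_mixOp (fun p => rfl) (fun p q => ?_) (fun p q h => ?_) (fun p q h => ?_)
  · simp only [on2_on1_apply, and_comm]
  all_goals
    rw [on2_on1_apply] at h
    have h1 := (ite_ne_right_iff.1 h)
    have h2 := hU _ _ h1.2
    simp only [addSite] at h2
    simp only [h1.1.1, h1.1.2, h2]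

/-- The new site is inert for `U`, so the undressed reflection equation, amplified along that site,
can be used inside the dressed one. -/
theorem on1_on1_eq_amp : on1 (on1 U) = amp (splitThird _ _) (on1 U) := by
  ext p q
  rw [on1_on1_apply]
  by_cases h1 : p.2.1 = q.2.1 <;> by_cases h2 : p.2.2.1 = q.2.2.1 <;>
    simp [on1, amp, splitFst, splitThird, h1, h2]

theorem on2_on1_eq_amp : on2 (on1 U) = amp (splitThird _ _) (on2 U) := by
  ext p q
  rw [on2_on1_apply]
  by_cases h1 : p.1 = q.1 <;> by_cases h2 : p.2.2.1 = q.2.2.1 <;>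
    simp [on2, amp, splitSnd, splitThird, h1, h2]

end Commute

/-- Dressing by a site preserves the dynamical reflection equation. -/
theorem Reflection.dress {η : ℂ} {T : ι → ℂ} {u v : ℂ}
    {U V : Matrix (Fin 2 × ι) (Fin 2 × ι) ℂ} (h : Reflection η T u v U V)
    (hU : Conserves η T U) (hV : Conserves η T V) (hT : ∀ s, sinh (T s) ≠ 0)
    (hm : ∀ s, sinh (T s - η) ≠ 0) (hp : ∀ s, sinh (T s + η) ≠ 0) (ξ : ℂ) :
    Reflection η (addSite η T) u v (dress η T ξ u U) (dress η T ξ v V) := by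
  -- In the sums `(u + ξ) + (v - ξ)` and `(v + ξ) + (u - ξ)`, as in the two differences, the
  -- inhomogeneity cancels. This leaves exactly the arguments `u ± v` of the reflection equation.
  have e1 := on1_ropHat_mul η T hT hm hp (u + ξ) (v - ξ)
  have e2 := rop_mul_on1 η T hT hm hp (u - ξ) (v - ξ)
  have e3 := ropHat_mul_shift31 η T hT hm hp (u + ξ) (u - v)
  have e4 := shift13_mul_rop η T hT hm hp (v + ξ) (u - ξ)
  rw [show u + ξ + (v - ξ) = u + v by ring] at e1
  rw [show u - ξ - (v - ξ) = u - v by ring] at e2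
  rw [show u + ξ - (u - v) = v + ξ by ring] at e3
  rw [show v + ξ + (u - ξ) = u + v by ring] at e4
  have c1 := on1_on1_commute_shift23 hU (v - ξ)
  have c2 := on1_on1_commute_shift32 hU (v + ξ)
  have c3 := on2_on1_commute_shift13 hV (u - ξ)
  have c4 := on2_on1_commute_shift31 hV (u + ξ)
  have h' := congrArg (amp (splitThird (Fin 2) ι)) h
  simp only [amp_mul, ← on1_on1_eq_amp, ← on2_on1_eq_amp] at h'
  unfold Reflection SOS.dress
  simp only [on1_mul, on2_mul]
  generalize on1 (on1 U) = U1 at *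
  generalize on2 (on1 V) = V2 at *
  generalize on1 (rop η T (u - ξ)) = a1 at *
  generalize on1 (ropHat η T (u + ξ)) = b1 at *
  generalize on2 (rop η T (v - ξ)) = a2 at *
  generalize on2 (ropHat η T (v + ξ)) = b2 at *
  generalize shift13 η T (u - ξ) = a1s at *
  generalize shift31 η T (u + ξ) = b1s at *
  generalize shift23 η T (v - ξ) = a2s at *
  generalize shift32 η T (v + ξ) = b2s at *
  generalize rop η (addSite η T) (u - v) = rm at *
  generalize rop η (addSite η T) (u + v) = rp at *
  generalize ropHat η (addSite η T) (u - v) = hm at *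
  generalize ropHat η (addSite η T) (u + v) = hp at *
  generalize amp (splitThird _ _) (rop η T (u - v)) = rm0 at *
  generalize amp (splitThird _ _) (rop η T (u + v)) = rp0 at *
  generalize amp (splitThird _ _) (ropHat η T (u - v)) = hm0 at *
  generalize amp (splitThird _ _) (ropHat η T (u + v)) = hp0 at *
  -- Sklyanin's dressing as a computation with words: Yang-Baxter moves the site matrices of `u` and
  -- `v` past each other, the commutations carry them through `U` and `V`, the old reflection
  -- equation acts in the middle (`h'`), and the moves are then undone on the other side.
  calc rm * (a1 * U1 * b1) * hp * (a2 * V2 * b2)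
      = rm * a1 * U1 * (b1 * hp * a2) * V2 * b2 := by simp only [mul_assoc]
    _ = rm * a1 * (U1 * a2s) * hp0 * (b1s * V2) * b2 := by rw [e1]; simp only [mul_assoc]
    _ = (rm * a1 * a2s) * U1 * hp0 * V2 * b1s * b2 := by rw [c1, ← c4]; simp only [mul_assoc]
    _ = a2 * a1s * (rm0 * U1 * hp0 * V2) * b1s * b2 := by rw [e2]; simp only [mul_assoc]
    _ = a2 * (a1s * V2) * rp0 * U1 * (hm0 * b1s * b2) := by rw [h']; simp only [mul_assoc]
    _ = a2 * (V2 * a1s) * rp0 * (U1 * b2s) * b1 * hm := by rw [e3, c3]; simp only [mul_assoc]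
    _ = a2 * V2 * (a1s * rp0 * b2s) * U1 * b1 * hm := by rw [c2]; simp only [mul_assoc]
    _ = a2 * V2 * b2 * rp * (a1 * U1 * b1) * hm := by rw [e4]; simp only [mul_assoc]

/-! ### Splitting off the first site of the chain. -/

section Recursion

/-- A configuration of `N + 1` spins is a first spin and a configuration of `N` spins. -/
def configEquiv (N : ℕ) : Config (N + 1) ≃ Fin 2 × Config N :=
  (Fin.consEquiv fun _ => Fin 2).symm

/-- The splitting of `V₀ ⊗ (ℂ²)^{⊗ (N + 1)}` along the first site. -/
def auxEquiv (N : ℕ) : Fin 2 × Config (N + 1) ≃ Fin 2 × Fin 2 × Config N :=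
  (Equiv.refl _).prodCongr (configEquiv N)

theorem auxEquiv_apply {N : ℕ} (p : Fin 2 × Config (N + 1)) :
    auxEquiv N p = (p.1, p.2 0, Fin.tail p.2) := rfl

/-- The dynamical parameter seen from the left of the chain. -/
def chainParam (η θ : ℂ) {N : ℕ} (s : Config N) : ℂ := θ - η * ∑ j, sz (s j)

theorem chainParam_succ (η θ : ℂ) {N : ℕ} (s : Config (N + 1)) :
    chainParam η θ s = addSite η (chainParam η θ) (configEquiv N s) := by
  simp only [chainParam, addSite, configEquiv, Fin.sum_univ_succ, Fin.consEquiv,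
    Equiv.coe_fn_symm_mk, Fin.tail]
  ring

/-- The first site sees the spins of all the others, that is, the total parameter of the shorter
chain. This is why the chain grows at its left end. -/
theorem siteParam_zero (η θ : ℂ) {N : ℕ} (s : Config (N + 1)) :
    siteParam η θ 0 s = chainParam η θ (Fin.tail s) := by
  have : Finset.Ioi (0 : Fin (N + 1)) = Finset.univ.map (Fin.succEmb N) := by
    ext j; simp [Fin.exists_succ_eq]
  simp [siteParam, chainParam, this, Fin.tail]

theorem siteParam_succ (η θ : ℂ) {N : ℕ} (m : Fin N) (s : Config (N + 1)) :
    siteParam η θ m.succ s = siteParam η θ m (Fin.tail s) := by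
  rw [siteParam, siteParam, ← Fin.map_succEmb_Ioi, Finset.sum_map]
  rfl

theorem on1_one {ι : Type*} [DecidableEq ι] : on1 (1 : Matrix (Fin 2 × ι) (Fin 2 × ι) ℂ) = 1 := by
  ext ⟨a, b, s⟩ ⟨a', b', s'⟩
  by_cases h1 : a = a' <;> by_cases h2 : b = b' <;> by_cases h3 : s = s' <;>
    simp [on1, amp, splitFst, Matrix.one_apply, h1, h2, h3]

/-- Adding a first site on which the operator acts trivially. -/
def addFirst (N : ℕ) : AuxOp N →* AuxOp (N + 1) where
  toFun M := (on1 M).submatrix (auxEquiv N) (auxEquiv N)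
  map_one' := by rw [on1_one, Matrix.submatrix_one_equiv]
  map_mul' M M' := by rw [on1_mul, Matrix.submatrix_mul_equiv]

theorem forall_ne_zero_iff {N : ℕ} (s t : Config (N + 1)) :
    (∀ j, j ≠ 0 → s j = t j) ↔ Fin.tail s = Fin.tail t := by
  rw [Fin.forall_fin_succ, funext_iff]
  simp [Fin.tail]

theorem forall_ne_succ_iff {N : ℕ} (m : Fin N) (s t : Config (N + 1)) :
    (∀ j, j ≠ m.succ → s j = t j) ↔
      s 0 = t 0 ∧ ∀ j, j ≠ m → Fin.tail s j = Fin.tail t j := by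
  rw [Fin.forall_fin_succ]
  simp [Fin.tail, (Fin.succ_ne_zero m).symm]

theorem siteR_zero (η θ : ℂ) (N : ℕ) (u : ℂ) :
    siteR η θ (0 : Fin (N + 1)) u =
      (rop η (chainParam η θ) u).submatrix (auxEquiv N) (auxEquiv N) := by
  ext ⟨a, s⟩ ⟨b, t⟩
  simp only [siteR, rop, mixOp, Matrix.of_apply, Matrix.submatrix_apply, auxEquiv_apply,
    forall_ne_zero_iff, dynR_apply, siteParam_zero, Prod.mk.injEq]
  by_cases h : Fin.tail s = Fin.tail t
  · simp only [h, if_true, true_and, and_comm]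
  · simp [h]

theorem siteRhat_zero (η θ : ℂ) (N : ℕ) (u : ℂ) :
    siteRhat η θ (0 : Fin (N + 1)) u =
      (ropHat η (chainParam η θ) u).submatrix (auxEquiv N) (auxEquiv N) := by
  ext ⟨a, s⟩ ⟨b, t⟩
  simp only [siteRhat, ropHat, mixOp, Matrix.of_apply, Matrix.submatrix_apply, auxEquiv_apply,
    forall_ne_zero_iff, dynR_apply, siteParam_zero, Prod.mk.injEq]
  by_cases h : Fin.tail s = Fin.tail t
  · simp only [h, if_true, true_and, and_comm]
  · simp [h]

theorem siteR_succ (η θ : ℂ) {N : ℕ} (m : Fin N) (u : ℂ) :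
    siteR η θ m.succ u = addFirst N (siteR η θ m u) := by
  ext ⟨a, s⟩ ⟨b, t⟩
  simp only [siteR, addFirst, on1, amp, splitFst, Matrix.of_apply, Matrix.submatrix_apply,
    auxEquiv_apply, forall_ne_succ_iff, siteParam_succ, MonoidHom.coe_mk, OneHom.coe_mk,
    Equiv.coe_fn_mk]
  by_cases h : s 0 = t 0
  · simp only [h, Fin.tail, true_and, if_true]
    congr
  · simp [h]

theorem siteRhat_succ (η θ : ℂ) {N : ℕ} (m : Fin N) (u : ℂ) :
    siteRhat η θ m.succ u = addFirst N (siteRhat η θ m u) := by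
  ext ⟨a, s⟩ ⟨b, t⟩
  simp only [siteRhat, addFirst, on1, amp, splitFst, Matrix.of_apply, Matrix.submatrix_apply,
    auxEquiv_apply, forall_ne_succ_iff, siteParam_succ, MonoidHom.coe_mk, OneHom.coe_mk,
    Equiv.coe_fn_mk]
  by_cases h : s 0 = t 0
  · simp only [h, Fin.tail, true_and, if_true]
    congr
  · simp [h]

theorem onAux_succ (N : ℕ) (K : Matrix (Fin 2) (Fin 2) ℂ) :
    (onAux K : AuxOp (N + 1)) = addFirst N (onAux K) := by
  ext ⟨a, s⟩ ⟨b, t⟩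
  have : s = t ↔ s 0 = t 0 ∧ Fin.tail s = Fin.tail t := by
    rw [← (configEquiv N).apply_eq_iff_eq, Prod.ext_iff]; rfl
  by_cases h : s 0 = t 0 <;> by_cases h' : Fin.tail s = Fin.tail t <;>
  simp [onAux, addFirst, on1, amp, splitFst, auxEquiv_apply, Matrix.one_apply, this, h, h']

theorem monodromy_succ (η θ : ℂ) {N : ℕ} (ξ : Fin (N + 1) → ℂ) (u : ℂ) :
    monodromy η θ ξ u = siteR η θ 0 (u - ξ 0) * addFirst N (monodromy η θ (Fin.tail ξ) u) := by
  simp only [monodromy, List.ofFn_succ, List.prod_cons, map_list_prod, List.map_ofFn, siteR_succ]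
  rfl

theorem monodromyHat_succ (η θ : ℂ) {N : ℕ} (ξ : Fin (N + 1) → ℂ) (u : ℂ) :
    monodromyHat η θ ξ u =
      addFirst N (monodromyHat η θ (Fin.tail ξ) u) * siteRhat η θ 0 (u + ξ 0) := by
  simp only [monodromyHat, List.ofFn_succ, List.reverse_cons, List.prod_append, map_list_prod,
    List.map_reverse, List.map_ofFn, siteRhat_succ, List.prod_cons, List.prod_nil, mul_one]
  rfl

/-- The first site carries the outermost factors on both sides of `K₋`, so everything between them
is the double row operator of the remaining sites. -/
theorem doubleRow_succ (η θ δ ζ : ℂ) {N : ℕ} (ξ : Fin (N + 1) → ℂ) (u : ℂ) :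
    doubleRow η θ δ ζ ξ u =
      (dress η (chainParam η θ) (ξ 0) u (doubleRow η θ δ ζ (Fin.tail ξ) u)).submatrix
        (auxEquiv N) (auxEquiv N) := by
  have h : addFirst N (doubleRow η θ δ ζ (Fin.tail ξ) u) =
      (on1 (doubleRow η θ δ ζ (Fin.tail ξ) u)).submatrix (auxEquiv N) (auxEquiv N) := rfl
  rw [dress, ← Matrix.submatrix_mul_equiv _ _ _ (auxEquiv N), ← Matrix.submatrix_mul_equiv _ _ _
    (auxEquiv N), ← siteR_zero, ← siteRhat_zero, ← h, doubleRow, doubleRow, monodromy_succ,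
    monodromyHat_succ, onAux_succ, map_mul, map_mul]
  simp only [mul_assoc]

end Recursion

/-! ### Conservation of total spin. -/

section Weight

/-- The spin `±1` as an integer. -/
def spin (a : Fin 2) : ℤ := if a = 0 then 1 else -1

theorem sz_eq_spin (a : Fin 2) : sz a = spin a := by
  unfold sz spin; split_ifs <;> simp

/-- Total spin of a configuration. -/
def weight {N : ℕ} (s : Config N) : ℤ := ∑ j, spin (s j)

theorem chainParam_eq_weight (η θ : ℂ) {N : ℕ} (s : Config N) :
    chainParam η θ s = θ - η * weight s := by
  simp [chainParam, weight, sz_eq_spin]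

/-- Operators on `V₀ ⊗ (ℂ²)^{⊗ N}` which commute with the total spin. -/
def Graded {N : ℕ} (M : AuxOp N) : Prop :=
  ∀ p q, M p q ≠ 0 → spin p.1 + weight p.2 = spin q.1 + weight q.2

theorem Graded.mul {N : ℕ} {M M' : AuxOp N} (h : Graded M) (h' : Graded M') :
    Graded (M * M') := by
  intro p q hpq
  rw [Matrix.mul_apply] at hpq
  obtain ⟨r, -, hr⟩ := Finset.exists_ne_zero_of_sum_ne_zero hpq
  exact (h p r (left_ne_zero_of_mul hr)).trans (h' r q (right_ne_zero_of_mul hr))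

theorem Graded.one {N : ℕ} : Graded (1 : AuxOp N) := by
  intro p q hpq
  have : p = q := by by_contra h; exact hpq (Matrix.one_apply_ne h)
  rw [this]

theorem Graded.list_prod {N : ℕ} (l : List (AuxOp N)) (h : ∀ M ∈ l, Graded M) :
    Graded l.prod := by
  induction l with
  | nil => exact Graded.one
  | cons M l ih =>
    rw [List.prod_cons]
    exact (h M (by simp)).mul (ih fun M' hM' => h M' (by simp [hM']))

theorem weight_eq_add_sum_erase {N : ℕ} (m : Fin N) (s : Config N) :
    weight s = spin (s m) + ∑ j ∈ Finset.univ.erase m, spin (s j) :=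
  (Finset.add_sum_erase _ _ (Finset.mem_univ m)).symm

theorem dynR_ne_zero {η u t : ℂ} {a b c d : Fin 2} (h : dynR η u t (a, b) (c, d) ≠ 0) :
    spin a + spin b = spin c + spin d := by
  rw [dynR_apply] at h
  by_cases h1 : a = c ∧ b = d
  · rw [h1.1, h1.2]
  by_cases h2 : a = d ∧ b = c
  · rw [h2.1, h2.2, add_comm]
  simp [h1, h2] at h

theorem graded_siteR (η θ : ℂ) {N : ℕ} (m : Fin N) (u : ℂ) : Graded (siteR η θ m u) := by
  intro p q hpq
  simp only [siteR, Matrix.of_apply, ne_eq, ite_eq_right_iff, Classical.not_imp] at hpq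
  rw [weight_eq_add_sum_erase m, weight_eq_add_sum_erase m q.2, ← add_assoc, ← add_assoc,
    dynR_ne_zero hpq.2, Finset.sum_congr rfl fun j hj => by
      rw [hpq.1 j (Finset.ne_of_mem_erase hj)]]

theorem graded_siteRhat (η θ : ℂ) {N : ℕ} (m : Fin N) (u : ℂ) : Graded (siteRhat η θ m u) := by
  intro p q hpq
  simp only [siteRhat, Matrix.of_apply, ne_eq, ite_eq_right_iff, Classical.not_imp] at hpq
  rw [weight_eq_add_sum_erase m, weight_eq_add_sum_erase m q.2, ← add_assoc, ← add_assoc,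
    add_comm (spin p.1), dynR_ne_zero hpq.2, add_comm (spin q.1), Finset.sum_congr rfl fun j hj => by
      rw [hpq.1 j (Finset.ne_of_mem_erase hj)]]

theorem graded_doubleRow (η θ δ ζ : ℂ) {N : ℕ} (ξ : Fin N → ℂ) (u : ℂ) :
    Graded (doubleRow η θ δ ζ ξ u) := by
  refine ((Graded.list_prod _ fun M hM => ?_).mul fun p q hpq => ?_).mul
    (Graded.list_prod _ fun M hM => ?_)
  · obtain ⟨m, rfl⟩ := (List.mem_ofFn).1 hM
    exact graded_siteR _ _ _ _
  · obtain ⟨a, s⟩ := p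
    obtain ⟨b, t⟩ := q
    by_cases h1 : a = b <;> by_cases h2 : s = t <;>
      simp_all [onAux, Kminus]
  · obtain ⟨m, rfl⟩ := (List.mem_ofFn).1 (List.mem_reverse.1 hM)
    exact graded_siteRhat _ _ _ _

/-- With the auxiliary spin included, the parameter is `θ - η` times the total spin. -/
theorem Graded.conserves {N : ℕ} {M : AuxOp N} (h : Graded M) (η θ : ℂ) :
    Conserves η (chainParam η θ) M := by
  intro p q hpq
  have := congrArg (Int.cast : ℤ → ℂ) (h p q hpq)
  push_cast at this
  simp only [addSite, chainParam_eq_weight, sz_eq_spin]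
  linear_combination -η * this

theorem abs_weight_le {N : ℕ} (s : Config N) : |weight s| ≤ N := by
  refine (Finset.abs_sum_le_sum_abs _ _).trans ?_
  have : ∀ a : Fin 2, |spin a| = 1 := by decide
  simp [this]

theorem weight_eq_iff {N : ℕ} (s : Config N) : weight s = N ↔ s = fun _ => 0 := by
  constructor
  · intro h
    by_contra hs
    obtain ⟨i, hi⟩ := Function.ne_iff.1 hs
    have hle : ∀ a : Fin 2, spin a ≤ 1 := by decide
    have hlt : spin (s i) < 1 := by
      have : ∀ a : Fin 2, a ≠ 0 → spin a < 1 := by decide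
      exact this _ hi
    have : weight s < ∑ _j : Fin N, (1 : ℤ) :=
      Finset.sum_lt_sum (fun j _ => hle _) ⟨i, Finset.mem_univ i, hlt⟩
    simp [h] at this
  · rintro rfl
    simp [weight, spin]

end Weight

/-! ### The reflection equation for the double row operator. -/

theorem Reflection.reindex {ι κ : Type*} [Fintype ι] [DecidableEq ι] [Fintype κ] [DecidableEq κ]
    (e : κ ≃ ι) {η : ℂ} {T : ι → ℂ} {u v : ℂ} {U V : Matrix (Fin 2 × ι) (Fin 2 × ι) ℂ}
    (h : Reflection η T u v U V) :
    Reflection η (T ∘ e) u v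
      (U.submatrix ((Equiv.refl _).prodCongr e) ((Equiv.refl _).prodCongr e))
      (V.submatrix ((Equiv.refl _).prodCongr e) ((Equiv.refl _).prodCongr e)) := by
  let E : Fin 2 × Fin 2 × κ ≃ Fin 2 × Fin 2 × ι :=
    (Equiv.refl _).prodCongr ((Equiv.refl _).prodCongr e)
  have hr : ∀ x, rop η (T ∘ e) x = (rop η T x).submatrix E E := fun x => by
    ext p q
    simp [rop, mixOp, E, Prod.ext_iff]
  have hr' : ∀ x, ropHat η (T ∘ e) x = (ropHat η T x).submatrix E E := fun x => by
    ext p q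
    simp [ropHat, mixOp, E, Prod.ext_iff]
  have h1 : on1 (U.submatrix ((Equiv.refl _).prodCongr e) ((Equiv.refl _).prodCongr e)) =
    (on1 U).submatrix E E := rfl
  have h2 : on2 (V.submatrix ((Equiv.refl _).prodCongr e) ((Equiv.refl _).prodCongr e)) =
    (on2 V).submatrix E E := rfl
  unfold Reflection at h ⊢
  simp only [hr, hr', h1, h2, Matrix.submatrix_mul_equiv, h]

theorem doubleRow_zero (η θ δ ζ : ℂ) (ξ : Fin 0 → ℂ) (u : ℂ) :
    doubleRow η θ δ ζ ξ u = onAux (Kminus δ ζ u) := by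
  simp [doubleRow, monodromy, monodromyHat]

theorem on1_onAux_diagonal {N : ℕ} (k : Fin 2 → ℂ) :
    on1 (onAux (Matrix.diagonal k) : AuxOp N) = Matrix.diagonal fun p => k p.1 := by
  ext ⟨a, b, s⟩ ⟨a', b', s'⟩
  by_cases h1 : a = a' <;> by_cases h2 : b = b' <;> by_cases h3 : s = s' <;>
    simp [on1, amp, splitFst, onAux, Matrix.one_apply, Matrix.diagonal_apply, h1, h2, h3]

theorem on2_onAux_diagonal {N : ℕ} (k : Fin 2 → ℂ) :
    on2 (onAux (Matrix.diagonal k) : AuxOp N) = Matrix.diagonal fun p => k p.2.1 := by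
  ext ⟨a, b, s⟩ ⟨a', b', s'⟩
  by_cases h1 : a = a' <;> by_cases h2 : b = b' <;> by_cases h3 : s = s' <;>
    simp [on2, amp, splitSnd, onAux, Matrix.one_apply, Matrix.diagonal_apply, h1, h2, h3]

/-- The diagonal boundary matrix solves the dynamical reflection equation. -/
theorem reflection_Kminus {η θ δ ζ u v : ℂ} (hθ : θ = δ - ζ) (h0 : sinh θ ≠ 0)
    (hδu : sinh (δ + u) ≠ 0) (hζu : sinh (ζ + u) ≠ 0) (hδv : sinh (δ + v) ≠ 0)
    (hζv : sinh (ζ + v) ≠ 0) {N : ℕ} :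
    Reflection η (fun _ : Config N => θ) u v (onAux (Kminus δ ζ u)) (onAux (Kminus δ ζ v)) := by
  -- The relation between the dynamical parameter and the boundary parameters is needed here: with
  -- `θ` replaced by `δ - ζ`, each component is an identity between hyperbolic functions.
  subst hθ
  refine matrix_ext_mulVec fun F => funext fun ⟨a, b, s⟩ => ?_
  simp only [← Matrix.mulVec_mulVec, Kminus, on1_onAux_diagonal, on2_onAux_diagonal, rop, ropHat,
    mixOp_mulVec, Matrix.mulVec_diagonal]
  fin_cases a <;> fin_cases b <;> simp [wDiag, wSwap, sz]
  all_goals field_simp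
  all_goals
    simp only [Complex.sinh, neg_add, sub_eq_add_neg, Complex.exp_add, Complex.exp_neg, neg_neg]
    field_simp [Complex.exp_ne_zero]
    ring

/-- The double row monodromy matrix solves the dynamical reflection equation. -/
theorem reflection_doubleRow {η θ δ ζ u v : ℂ} (hθ : θ = δ - ζ)
    (hδu : sinh (δ + u) ≠ 0) (hζu : sinh (ζ + u) ≠ 0) (hδv : sinh (δ + v) ≠ 0)
    (hζv : sinh (ζ + v) ≠ 0) {N : ℕ} (h : ∀ k : ℤ, |k| ≤ N → sinh (θ - η * k) ≠ 0)
    (ξ : Fin N → ℂ) :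
    Reflection η (chainParam η θ) u v (doubleRow η θ δ ζ ξ u) (doubleRow η θ δ ζ ξ v) := by
  induction N with
  | zero =>
    rw [doubleRow_zero, doubleRow_zero]
    have : chainParam η θ = fun _ : Config 0 => θ := by ext s; simp [chainParam]
    rw [this]
    exact reflection_Kminus hθ (by simpa using h 0 (by simp)) hδu hζu hδv hζv
  | succ N ih =>
    -- Dressing needs `sinh` nonzero at the parameter of the shorter chain and at its shifts by
    -- `±η`. The resulting index has absolute value at most `N + 1`, which is the bound available
    -- for the longer chain.
    have hw : ∀ (s : Config N) (j : ℤ), |j| ≤ 1 → sinh (chainParam η θ s - η * j) ≠ 0 := by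
      intro s j hj
      have := h (weight s + j) ((abs_add_le _ _).trans (by
        push_cast; exact add_le_add (abs_weight_le s) hj))
      rw [chainParam_eq_weight]
      convert this using 2
      push_cast; ring
    have := ((ih (fun k hk => h k (hk.trans (by simp))) (Fin.tail ξ)).dress
      ((graded_doubleRow _ _ _ _ _ _).conserves _ _) ((graded_doubleRow _ _ _ _ _ _).conserves _ _)
      (fun s => by simpa using hw s 0 (by simp)) (fun s => by simpa using hw s 1 (by simp))
      (fun s => by simpa using hw s (-1) (by simp)) (ξ 0)).reindex (configEquiv N)
    have hc : chainParam η θ = addSite η (chainParam η θ) ∘ configEquiv N :=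
      funext fun s => chainParam_succ η θ s
    rw [hc, doubleRow_succ, doubleRow_succ]
    exact this

/-! ### The action on the reference state. -/

section Reference

theorem mixOp_mul_apply {X : Type*} [Fintype X] [DecidableEq X] (w v : X → ℂ) (σ : X → X)
    (M : Matrix X X ℂ) (p q : X) : (mixOp w v σ * M) p q = w p * M p q + v p * M (σ p) q := by
  simp [mixOp, Matrix.mul_apply, add_mul, Finset.sum_add_distrib, ite_mul]

theorem mul_mixOp_apply {X : Type*} [Fintype X] [DecidableEq X] (w v : X → ℂ) {σ : X → X}
    (hσ : ∀ p, σ (σ p) = p) (M : Matrix X X ℂ) (p q : X) :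
    (M * mixOp w v σ) p q = M p q * w q + M p (σ q) * v (σ q) := by
  have hσ' : ∀ p q, σ p = q ↔ p = σ q := fun p q =>
    ⟨fun h => by rw [← h, hσ], fun h => by rw [h, hσ]⟩
  simp [mixOp, Matrix.mul_apply, mul_add, Finset.sum_add_distrib, mul_ite, hσ']

/-- The eigenvalue of `A₋(u)` on the reference state. -/
def refA (η δ : ℂ) {N : ℕ} (ξ : Fin N → ℂ) (u : ℂ) : ℂ :=
  sinh (δ - u) / sinh (δ + u) * ∏ j, (sinh (u + ξ j + η) * sinh (u - ξ j + η))

/-- The eigenvalue on the reference state of the companion of `A₋(u)`. -/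
def refE (η δ ζ : ℂ) {N : ℕ} (ξ : Fin N → ℂ) (u : ℂ) : ℂ :=
  sinh (2 * u) * (sinh (δ + u + η) * sinh (ζ - u - η)) / (sinh (δ + u) * sinh (ζ + u))
    * ∏ j, (sinh (u + ξ j) * sinh (u - ξ j))

/-- All spins involved are equal, so the exchange weights vanish and each site contributes only its
two diagonal weights. -/
theorem doubleRow_ref_zero (η θ δ ζ : ℂ) {N : ℕ} (ξ : Fin N → ℂ) (u : ℂ) :
    doubleRow η θ δ ζ ξ u (0, fun _ => 0) (0, fun _ => 0) = refA η δ ξ u := by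
  induction N with
  | zero => simp [doubleRow_zero, onAux, Kminus, refA]
  | succ N ih =>
    rw [doubleRow_succ]
    simp only [Matrix.submatrix_apply, auxEquiv_apply, dress, rop, ropHat]
    have ht : Fin.tail (fun _ : Fin (N + 1) => (0 : Fin 2)) = fun _ => 0 := rfl
    rw [mul_mixOp_apply _ _ (fun p => rfl)]
    simp only [mixOp_mul_apply, ht]
    simp [wDiag, wSwap, on1, amp, splitFst, ih]
    simp only [refA, Fin.prod_univ_succ, Fin.tail]
    ring

/-- A down auxiliary spin can be exchanged with an up site spin, so `D₋` alone picks up a multiple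
of `A₋` at every site. Subtracting a suitable multiple of `A₋`, which depends on the parameter,
restores a product formula. The denominators are cleared so that the induction is linear. -/
theorem doubleRow_ref_one {η θ δ ζ : ℂ} (hθ : θ = δ - ζ) {N : ℕ}
    (h : ∀ k : ℤ, |k| ≤ N → sinh (θ - η * k) ≠ 0) (ξ : Fin N → ℂ) {u : ℂ}
    (hδu : sinh (δ + u) ≠ 0) (hζu : sinh (ζ + u) ≠ 0) :
    sinh (θ - η * N + η) * sinh (2 * u + η) *
        doubleRow η θ δ ζ ξ u (1, fun _ => 0) (1, fun _ => 0) -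
      sinh η * sinh (θ - η * N + 2 * u + η) * refA η δ ξ u =
      sinh (θ - η * N) * refE η δ ζ ξ u := by
  induction N with
  | zero =>
    simp [doubleRow_zero, onAux, Kminus, refA, refE]
    subst hθ
    field_simp
    simp only [Complex.sinh, two_mul, neg_add, sub_eq_add_neg, Complex.exp_add,
      Complex.exp_neg, neg_neg]
    field_simp [Complex.exp_ne_zero]
    ring
  | succ N ih =>
    have ih := ih (fun k hk => h k (hk.trans (by simp))) (Fin.tail ξ)
    rw [doubleRow_succ]
    simp only [Matrix.submatrix_apply, auxEquiv_apply, dress, rop, ropHat]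
    have ht : Fin.tail (fun _ : Fin (N + 1) => (0 : Fin 2)) = fun _ => 0 := rfl
    rw [mul_mixOp_apply _ _ (fun p => rfl)]
    simp only [mixOp_mul_apply, ht]
    have hA := doubleRow_ref_zero η θ δ ζ (Fin.tail ξ) u
    have hr : refA η δ ξ u = refA η δ (Fin.tail ξ) u *
        (sinh (u + ξ 0 + η) * sinh (u - ξ 0 + η)) := by
      simp only [refA, Fin.prod_univ_succ, Fin.tail]; ring
    have hE : refE η δ ζ ξ u = refE η δ ζ (Fin.tail ξ) u *
        (sinh (u + ξ 0) * sinh (u - ξ 0)) := by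
      simp only [refE, Fin.prod_univ_succ, Fin.tail]; ring
    have hT : sinh (θ - η * N) ≠ 0 := by simpa using h N (by simp)
    rw [hr, hE]
    simp only [on1, amp, splitFst, Matrix.of_apply, Equiv.coe_fn_mk, hA]
    generalize refA η δ (Fin.tail ξ) u = rA at *
    generalize refE η δ ζ (Fin.tail ξ) u = rE at *
    generalize doubleRow η θ δ ζ (Fin.tail ξ) u (1, fun _ => 0) (1, fun _ => 0) = rD at *
    simp [wDiag, wSwap, chainParam, sz]
    have e1 : θ - η * (N + 1) = θ - η * N - η := by ring
    rw [e1]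
    generalize θ - η * N = T at *
    generalize ξ 0 = x at *
    -- After the induction hypothesis has accounted for `rD` and `rE`, this is the remaining
    -- coefficient of `rA`, up to the factor `sinh η`.
    have key : sinh (2 * u + η) * sinh η * (sinh (T - (x - u)) * sinh (T - (-x + -u))) +
        sinh (u - x) * sinh (u + x) * sinh (T - η) * sinh (T + 2 * u + η) -
        sinh T * sinh (T - η + 2 * u + η) * (sinh (u + x + η) * sinh (u - x + η)) = 0 := by
      simp only [Complex.sinh, two_mul, neg_add, sub_eq_add_neg, Complex.exp_add,
        Complex.exp_neg, neg_neg]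
      field_simp [Complex.exp_ne_zero]
      ring
    rw [sub_add_cancel]
    field_simp
    linear_combination (sinh (u - x) * sinh (u + x) * sinh (T - η)) * ih + rA * sinh η * key

end Reference

/-! ### Exchange coefficients and the identities that determine them. -/

/-- Diagonal exchange coefficient of `A₋(u)` and `B₋(v)`. -/
def exA (η u v : ℂ) : ℂ :=
  sinh (u - v - η) * sinh (u + v) / (sinh (u + v + η) * sinh (u - v))

/-- Diagonal exchange coefficient of the companion of `A₋(u)` and `B₋(v)`. -/
def exE (η u v : ℂ) : ℂ :=
  sinh (u - v + η) * sinh (u + v + 2 * η) / (sinh (u + v + η) * sinh (u - v))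

/-- Coefficient of `B₋(u) A₋(v)` in `A₋(u) B₋(v)`. -/
def exAA (η u v τ : ℂ) : ℂ :=
  -sinh η * sinh (2 * v) * sinh (τ + v - u) / (sinh τ * sinh (2 * v + η) * sinh (v - u))

/-- Coefficient of `B₋(u) E₋(v)` in `A₋(u) B₋(v)`. -/
def exAE (η u v τ : ℂ) : ℂ :=
  -sinh η * sinh (τ - η - u - v) / (sinh τ * sinh (2 * v + η) * sinh (u + v + η))

/-- Coefficient of `B₋(u) A₋(v)` in `E₋(u) B₋(v)`. -/
def exEA (η u v τ : ℂ) : ℂ :=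
  sinh η * sinh (2 * u + 2 * η) * sinh (2 * v) * sinh (τ + η + u + v) /
    (sinh τ * sinh (2 * v + η) * sinh (u + v + η))

/-- Coefficient of `B₋(u) E₋(v)` in `E₋(u) B₋(v)`. -/
def exEE (η u v τ : ℂ) : ℂ :=
  sinh η * sinh (2 * u + 2 * η) * sinh (τ + u - v) /
    (sinh τ * sinh (2 * v + η) * sinh (v - u))

section Identities

variable {η u v τ : ℂ}

/-- This and the next two identities compare coefficients in `reflection_AB` once `D₋` has been
eliminated in favour of the companion. -/
theorem exA_identity_wanted (h2 : sinh (τ - η) ≠ 0)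
    (huv : sinh (u + v + η) ≠ 0) (hd : sinh (v - u) ≠ 0) :
    sinh (v - u + η) * (sinh (u + v) * sinh (τ - η - η) / sinh (τ - η)) =
      sinh (u + v + η) * (sinh (v - u) * sinh (τ - η - η) / sinh (τ - η)) * exA η u v := by
  have e : u - v = -(v - u) := by ring
  have e' : u - v - η = -(v - u + η) := by ring
  rw [exA, e', e, Complex.sinh_neg, Complex.sinh_neg]
  field_simp

theorem exA_identity_from_A (h1 : sinh τ ≠ 0) (h2 : sinh (τ - η) ≠ 0) (hv : sinh (2 * v + η) ≠ 0)
    (hd : sinh (v - u) ≠ 0) :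
    sinh (u + v) * sinh (τ - η - η) / sinh (τ - η) *
        (sinh η * sinh (τ - η + (v - u)) / sinh (τ - η)) +
      sinh η * sinh (τ - η - (u + v)) / sinh (τ - η) *
        (sinh (v - u) * sinh (τ - η - η) / sinh (τ - η)) *
        (sinh η * sinh (τ - η + 2 * v + η) / (sinh τ * sinh (2 * v + η))) =
      -(sinh (u + v + η) * (sinh (v - u) * sinh (τ - η - η) / sinh (τ - η)) *
        exAA η u v τ) := by
  rw [exAA]
  generalize hx : sinh (2 * v + η) = x at *
  field_simp
  subst hx
  simp only [Complex.sinh, two_mul, mul_two, neg_add, sub_eq_add_neg, Complex.exp_add,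
    Complex.exp_neg, neg_neg]
  field_simp [Complex.exp_ne_zero]
  ring

theorem exA_identity_from_E (h1 : sinh τ ≠ 0) (h2 : sinh (τ - η) ≠ 0)
    (huv : sinh (u + v + η) ≠ 0) (hd : sinh (v - u) ≠ 0) :
      sinh η * sinh (τ - η - (u + v)) / sinh (τ - η) *
        (sinh (v - u) * sinh (τ - η - η) / sinh (τ - η)) *
        (sinh (τ - η) / (sinh τ * sinh (2 * v + η))) =
      -(sinh (u + v + η) * (sinh (v - u) * sinh (τ - η - η) / sinh (τ - η)) *
        exAE η u v τ) := by
  rw [exAE, show τ - η - (u + v) = τ - η - u - v by ring]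
  field_simp

/-- This is the purpose of the companion: the left side is the coefficient of `B(v) A(u)` that would
appear in `E(u) B(v)`, and it is zero. The remaining `exE` identities give the coefficients that
survive. -/
theorem exE_identity_cancel (h1 : sinh τ ≠ 0) (h2 : sinh (τ + η) ≠ 0) (hv : sinh (2 * u + η) ≠ 0)
    (huv : sinh (u + v + η) ≠ 0) (hd : sinh (u - v) ≠ 0) :
    sinh (τ + η + η) * sinh (2 * u + η) / sinh (τ + η) *
      (-(sinh η * sinh (τ + η + (u - v)) / sinh (τ + η)) *
          (sinh η * sinh (τ + η + (u + v)) / sinh (τ + η)) * exA η u v +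
        sinh (u - v + η) * sinh (u + v + η) *
          (sinh η * sinh (τ - η + 2 * u + η) / (sinh τ * sinh (2 * u + η))) +
        sinh (u - v + η) * (sinh η * sinh (τ + η + (u + v)) / sinh (τ + η)) * exAA η v u τ) -
      sinh (u - v) * sinh (τ + η + η) / sinh (τ + η) *
        (sinh (u + v) * sinh (τ + η - η) / sinh (τ + η)) *
        (sinh η * sinh (τ + η + 2 * u + η) / sinh (τ + η)) * exA η u v = 0 := by
  rw [exA, exAA]
  generalize hx : sinh (2 * u + η) = x at *
  field_simp
  subst hx
  simp only [Complex.sinh, two_mul, mul_two, neg_add, sub_eq_add_neg, Complex.exp_add,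
    Complex.exp_neg, neg_neg]
  field_simp [Complex.exp_ne_zero]
  ring

theorem exE_identity_wanted (h1 : sinh τ ≠ 0) (h2 : sinh (τ + η) ≠ 0) (hv : sinh (2 * u + η) ≠ 0)
    (huv : sinh (u + v + η) ≠ 0) (hd : sinh (u - v) ≠ 0) :
    sinh (τ + η + η) * sinh (2 * u + η) / sinh (τ + η) *
      (sinh (u - v + η) * sinh (u + v + η) *
          (sinh (τ - η) / (sinh τ * sinh (2 * u + η))) +
        sinh (u - v + η) * (sinh η * sinh (τ + η + (u + v)) / sinh (τ + η)) * exAE η v u τ) =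
      sinh (u - v) * sinh (τ + η + η) / sinh (τ + η) *
        (sinh (u + v) * sinh (τ + η - η) / sinh (τ + η)) * exE η u v := by
  rw [exE, exAE]
  generalize hx : sinh (2 * u + η) = x at *
  rw [show v + u + η = u + v + η by ring, add_sub_cancel_right]
  field_simp
  subst hx
  simp only [Complex.sinh, mul_two, neg_add, sub_eq_add_neg, Complex.exp_add,
    Complex.exp_neg, neg_neg]
  field_simp [Complex.exp_ne_zero]
  ring

theorem exE_identity_from_A (h1 : sinh τ ≠ 0) (h2 : sinh (τ + η) ≠ 0) (hv : sinh (2 * v + η) ≠ 0)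
    (huv : sinh (u + v + η) ≠ 0) (hd : sinh (v - u) ≠ 0) :
    sinh (τ + η + η) * sinh (2 * u + η) / sinh (τ + η) *
      (-(sinh η * sinh (τ + η + (u - v)) / sinh (τ + η)) *
          (sinh η * sinh (τ + η + (u + v)) / sinh (τ + η)) * exAA η u v τ -
        sinh η * sinh (τ + η + (u - v)) / sinh (τ + η) * sinh (u + v + η) *
          (sinh η * sinh (τ - η + 2 * v + η) / (sinh τ * sinh (2 * v + η))) +
        sinh (u - v + η) * (sinh η * sinh (τ + η + (u + v)) / sinh (τ + η)) * exA η v u) -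
      sinh (u - v) * sinh (τ + η + η) / sinh (τ + η) *
        (sinh (u + v) * sinh (τ + η - η) / sinh (τ + η)) *
        (sinh η * sinh (τ + η + 2 * u + η) / sinh (τ + η)) * exAA η u v τ =
      sinh (u - v) * sinh (τ + η + η) / sinh (τ + η) *
        (sinh (u + v) * sinh (τ + η - η) / sinh (τ + η)) * exEA η u v τ := by
  rw [exA, exAA, exEA]
  generalize hx : sinh (2 * v + η) = x at *
  rw [show v + u + η = u + v + η by ring, add_sub_cancel_right]
  field_simp
  subst hx
  simp only [Complex.sinh, two_mul, neg_add, sub_eq_add_neg, Complex.exp_add,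
    Complex.exp_neg, neg_neg]
  field_simp [Complex.exp_ne_zero]
  ring

theorem exE_identity_from_E (h1 : sinh τ ≠ 0) (h2 : sinh (τ + η) ≠ 0) (hv : sinh (2 * v + η) ≠ 0)
    (huv : sinh (u + v + η) ≠ 0) (hd : sinh (v - u) ≠ 0) :
    sinh (τ + η + η) * sinh (2 * u + η) / sinh (τ + η) *
      (-(sinh η * sinh (τ + η + (u - v)) / sinh (τ + η)) *
          (sinh η * sinh (τ + η + (u + v)) / sinh (τ + η)) * exAE η u v τ -
        sinh η * sinh (τ + η + (u - v)) / sinh (τ + η) * sinh (u + v + η) *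
          (sinh (τ - η) / (sinh τ * sinh (2 * v + η)))) -
      sinh (u - v) * sinh (τ + η + η) / sinh (τ + η) *
        (sinh (u + v) * sinh (τ + η - η) / sinh (τ + η)) *
        (sinh η * sinh (τ + η + 2 * u + η) / sinh (τ + η)) * exAE η u v τ =
      sinh (u - v) * sinh (τ + η + η) / sinh (τ + η) *
        (sinh (u + v) * sinh (τ + η - η) / sinh (τ + η)) * exEE η u v τ := by
  rw [exAE, exEE]
  generalize hx : sinh (2 * v + η) = x at *
  rw [add_sub_cancel_right]
  field_simp
  subst hx
  simp only [Complex.sinh, two_mul, neg_add, sub_eq_add_neg, Complex.exp_add,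
    Complex.exp_neg, neg_neg]
  field_simp [Complex.exp_ne_zero]
  ring

end Identities

/-! ### Exchange relations from blocks of the reflection equation. -/

/-- The block of an operator on two auxiliary spaces and the chain. -/
def block {N : ℕ} (X : Matrix (Fin 2 × Fin 2 × Config N) (Fin 2 × Fin 2 × Config N) ℂ)
    (a b c d : Fin 2) : Op N :=
  Matrix.of fun s t => X (a, b, s) (c, d, t)

theorem block_mul {N : ℕ}
    (X Y : Matrix (Fin 2 × Fin 2 × Config N) (Fin 2 × Fin 2 × Config N) ℂ) (a b c d : Fin 2) :
    block (X * Y) a b c d = ∑ e, ∑ f, block X a b e f * block Y e f c d := by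
  ext s t
  simp [block, Matrix.mul_apply, Fintype.sum_prod_type]

theorem block_on1 {N : ℕ} (M : AuxOp N) (a b c d : Fin 2) :
    block (on1 M) a b c d = if b = d then entry M a c else 0 := by
  ext s t
  by_cases h : b = d <;> simp [block, on1, amp, splitFst, entry, h]

theorem block_on2 {N : ℕ} (M : AuxOp N) (a b c d : Fin 2) :
    block (on2 M) a b c d = if a = c then entry M b d else 0 := by
  ext s t
  by_cases h : a = c <;> simp [block, on2, amp, splitSnd, entry, h]

/-- The operator which multiplies by a function of the dynamical parameter. -/
def paramOp {N : ℕ} (η θ : ℂ) (c : ℂ → ℂ) : Op N :=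
  Matrix.diagonal fun s => c (chainParam η θ s)

theorem block_rop {N : ℕ} (η θ u : ℂ) (a b c d : Fin 2) :
    block (rop η (chainParam η θ : Config N → ℂ) u) a b c d =
      (if a = c ∧ b = d then paramOp η θ fun t => wDiag η u t a b else 0) +
      (if b = c ∧ a = d then paramOp η θ fun t => wSwap η u t a b else 0) := by
  ext s t
  by_cases h : s = t
  · subst h
    simp only [block, rop, mixOp, paramOp, Matrix.of_apply, Prod.mk.injEq, and_true]
    split_ifs <;> simp
  · simp only [block, rop, mixOp, paramOp, Matrix.of_apply, Prod.mk.injEq, h, and_false, if_false]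
    split_ifs <;> simp [h]

theorem block_ropHat {N : ℕ} (η θ u : ℂ) (a b c d : Fin 2) :
    block (ropHat η (chainParam η θ : Config N → ℂ) u) a b c d =
      (if a = c ∧ b = d then paramOp η θ fun t => wDiag η u t b a else 0) +
      (if b = c ∧ a = d then paramOp η θ fun t => wSwap η u t b a else 0) := by
  ext s t
  by_cases h : s = t
  · subst h
    simp only [block, ropHat, mixOp, paramOp, Matrix.of_apply, Prod.mk.injEq, and_true]
    split_ifs <;> simp
  · simp only [block, ropHat, mixOp, paramOp, Matrix.of_apply, Prod.mk.injEq, h, and_false, if_false]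
    split_ifs <;> simp [h]

/-- Vectors of total spin `k`. -/
def weightSpace (N : ℕ) (k : ℤ) : Submodule ℂ (Config N → ℂ) where
  carrier := {x | ∀ s, x s ≠ 0 → weight s = k}
  zero_mem' := by simp
  add_mem' {x y} hx hy s hs := by
    by_cases h : x s = 0
    · exact hy s fun h' => hs (by simp [h, h'])
    · exact hx s h
  smul_mem' c x hx s hs := hx s (right_ne_zero_of_mul hs)

/-- This is where the dynamical algebra becomes scalar: on a space of fixed weight, functions of the
parameter are numbers. -/
theorem paramOp_mulVec {N : ℕ} (η θ : ℂ) (c : ℂ → ℂ) {k : ℤ} {x : Config N → ℂ}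
    (hx : x ∈ weightSpace N k) : paramOp η θ c *ᵥ x = c (θ - η * k) • x := by
  ext s
  rw [paramOp, Matrix.mulVec_diagonal, Pi.smul_apply, smul_eq_mul]
  by_cases h : x s = 0
  · simp [h]
  · rw [chainParam_eq_weight, hx s h]

theorem Graded.entry_mulVec_mem {N : ℕ} {M : AuxOp N} (hM : Graded M) (a b : Fin 2) {k l : ℤ}
    {x : Config N → ℂ} (hx : x ∈ weightSpace N k) (hl : spin a + l = spin b + k) :
    entry M a b *ᵥ x ∈ weightSpace N l := by
  intro s hs
  obtain ⟨t, -, ht⟩ := Finset.exists_ne_zero_of_sum_ne_zero hs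
  have h1 := hM (a, s) (b, t) (left_ne_zero_of_mul ht)
  have h2 := hx t (right_ne_zero_of_mul ht)
  simp only at h1
  omega

/-- The matrix `E₋(u) = (sinh(t + η) sinh(2u + η) D₋(u) - sinh η sinh(t + 2u + η) A₋(u)) / sinh t`
built from a double row operator, the companion of `A₋(u)`. -/
def companion {N : ℕ} (η θ u : ℂ) (M : AuxOp N) : Op N :=
  paramOp η θ (fun t => sinh (t + η) * sinh (2 * u + η) / sinh t) * entry M 1 1 -
    paramOp η θ (fun t => sinh η * sinh (t + 2 * u + η) / sinh t) * entry M 0 0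

section Exchange

variable {N : ℕ} {η θ u v : ℂ} {U V : AuxOp N} {k : ℤ} {x : Config N → ℂ}
  {τ : ℂ}

theorem companion_mulVec (hU : Graded U) (hx : x ∈ weightSpace N k) :
    companion η θ u U *ᵥ x =
      (sinh (θ - η * k + η) * sinh (2 * u + η) / sinh (θ - η * k)) • (entry U 1 1 *ᵥ x) -
      (sinh η * sinh (θ - η * k + 2 * u + η) / sinh (θ - η * k)) • (entry U 0 0 *ᵥ x) := by
  rw [companion, Matrix.sub_mulVec, ← Matrix.mulVec_mulVec, ← Matrix.mulVec_mulVec,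
    paramOp_mulVec _ _ _ (hU.entry_mulVec_mem 1 1 hx rfl),
    paramOp_mulVec _ _ _ (hU.entry_mulVec_mem 0 0 hx rfl)]

/-- The definition of the companion is solved for `D₋`. The variable `τ` lies midway between the
parameter `τ - η` on weight `k` and the parameter `τ + η` on weight `k - 2`, where `B₋` lands. -/
theorem entry_one_one_mulVec (hU : Graded U) (hx : x ∈ weightSpace N k)
    (hτ : θ - η * k = τ - η) (h1 : sinh τ ≠ 0) (h2 : sinh (τ - η) ≠ 0)
    (hu : sinh (2 * u + η) ≠ 0) :
    entry U 1 1 *ᵥ x =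
      (sinh η * sinh (τ - η + 2 * u + η) / (sinh τ * sinh (2 * u + η))) • (entry U 0 0 *ᵥ x) +
      (sinh (τ - η) / (sinh τ * sinh (2 * u + η))) • (companion η θ u U *ᵥ x) := by
  rw [companion_mulVec hU hx, hτ, sub_add_cancel]
  generalize sinh (2 * u + η) = d at *
  match_scalars <;> field_simp
  ring

theorem reflection_BB (h : Reflection η (chainParam η θ) u v U V) (hU : Graded U) (hV : Graded V)
    (hx : x ∈ weightSpace N k) (hτ : θ - η * k = τ - η) :
    (sinh (u + v) * sinh (τ + η - η) / sinh (τ + η) * sinh (u - v + η)) •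
        (entry U 0 1 *ᵥ (entry V 0 1 *ᵥ x)) =
      (sinh (u - v + η) * (sinh (u + v) * sinh (τ + η - η) / sinh (τ + η))) •
        (entry V 0 1 *ᵥ (entry U 0 1 *ᵥ x)) := by
  have hUx : entry U 0 1 *ᵥ x ∈ weightSpace N (k - 2) :=
    hU.entry_mulVec_mem 0 1 hx (by simp [spin]; ring)
  have hVx : entry V 0 1 *ᵥ x ∈ weightSpace N (k - 2) :=
    hV.entry_mulVec_mem 0 1 hx (by simp [spin]; ring)
  have hUVx := hU.entry_mulVec_mem 0 1 hVx (l := k - 2 - 2) (by simp [spin]; ring)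
  have e : θ - η * ((k : ℂ) - 2) = τ + η := by linear_combination hτ
  have := congrArg (fun M => block M 0 0 1 1 *ᵥ x) h
  simpa [block_mul, block_on1, block_on2, block_rop, block_ropHat, Fin.sum_univ_two,
    ← Matrix.mulVec_mulVec, wDiag, wSwap, sz, Matrix.add_mulVec, paramOp_mulVec _ _ _ hx,
    paramOp_mulVec _ _ _ hUx, paramOp_mulVec _ _ _ hVx, paramOp_mulVec _ _ _ hUVx,
    Matrix.mulVec_smul, smul_smul, e] using this

theorem reflection_AB (h : Reflection η (chainParam η θ) v u V U) (hU : Graded U) (hV : Graded V)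
    (hx : x ∈ weightSpace N k) (hτ : θ - η * k = τ - η) :
    (sinh (v - u + η) * (sinh (u + v) * sinh (τ - η - η) / sinh (τ - η))) •
        (entry V 0 1 *ᵥ (entry U 0 0 *ᵥ x)) =
      (sinh (u + v) * sinh (τ - η - η) / sinh (τ - η) *
          (sinh η * sinh (τ - η + (v - u)) / sinh (τ - η))) •
        (entry U 0 1 *ᵥ (entry V 0 0 *ᵥ x)) +
      (sinh (u + v + η) * (sinh (v - u) * sinh (τ - η - η) / sinh (τ - η))) •
        (entry U 0 0 *ᵥ (entry V 0 1 *ᵥ x)) +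
      (sinh η * sinh (τ - η - (u + v)) / sinh (τ - η) *
          (sinh (v - u) * sinh (τ - η - η) / sinh (τ - η))) •
        (entry U 0 1 *ᵥ (entry V 1 1 *ᵥ x)) := by
  have hUx : entry U 0 0 *ᵥ x ∈ weightSpace N k := hU.entry_mulVec_mem 0 0 hx rfl
  have hVx : entry V 0 0 *ᵥ x ∈ weightSpace N k := hV.entry_mulVec_mem 0 0 hx rfl
  have hVx' : entry V 1 1 *ᵥ x ∈ weightSpace N k := hV.entry_mulVec_mem 1 1 hx rfl
  have hBx : entry V 0 1 *ᵥ x ∈ weightSpace N (k - 2) :=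
    hV.entry_mulVec_mem 0 1 hx (by simp [spin]; ring)
  have hBUx : entry V 0 1 *ᵥ entry U 0 0 *ᵥ x ∈ weightSpace N (k - 2) :=
    hV.entry_mulVec_mem 0 1 hUx (by simp [spin]; ring)
  have := congrArg (fun M => block M 0 0 1 0 *ᵥ x) h
  simp [block_mul, block_on1, block_on2, block_rop, block_ropHat, Fin.sum_univ_two,
    ← Matrix.mulVec_mulVec, wDiag, wSwap, sz, Matrix.add_mulVec, paramOp_mulVec _ _ _ hx,
    paramOp_mulVec _ _ _ hUx, paramOp_mulVec _ _ _ hVx, paramOp_mulVec _ _ _ hVx',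
    paramOp_mulVec _ _ _ hBx, paramOp_mulVec _ _ _ hBUx,
    Matrix.mulVec_smul, smul_smul, hτ] at this
  rw [add_comm v u, show τ - η - (u - v) = τ - η + (v - u) by ring] at this
  ext s
  have hs := congrFun this s
  simp only [Pi.add_apply, Pi.smul_apply, smul_eq_mul] at hs ⊢
  linear_combination hs

theorem reflection_DB (h : Reflection η (chainParam η θ) u v U V) (hU : Graded U) (hV : Graded V)
    (hx : x ∈ weightSpace N k) (hτ : θ - η * k = τ - η) :
    (sinh η * sinh (τ + η + (u - v)) / sinh (τ + η) *
          (sinh η * sinh (τ + η + (u + v)) / sinh (τ + η))) •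
        (entry U 0 0 *ᵥ (entry V 0 1 *ᵥ x)) +
      (sinh η * sinh (τ + η + (u - v)) / sinh (τ + η) *
          sinh (u + v + η)) • (entry U 0 1 *ᵥ (entry V 1 1 *ᵥ x)) +
      (sinh (u - v) * sinh (τ + η + η) / sinh (τ + η) *
          (sinh (u + v) * sinh (τ + η - η) / sinh (τ + η))) •
        (entry U 1 1 *ᵥ (entry V 0 1 *ᵥ x)) =
      (sinh (u - v + η) * sinh (u + v + η)) • (entry V 0 1 *ᵥ (entry U 1 1 *ᵥ x)) +
      (sinh (u - v + η) *
        (sinh η * sinh (τ + η + (u + v)) / sinh (τ + η))) •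
        (entry V 0 0 *ᵥ (entry U 0 1 *ᵥ x)) := by
  have hUx : entry U 0 1 *ᵥ x ∈ weightSpace N (k - 2) :=
    hU.entry_mulVec_mem 0 1 hx (by simp [spin]; ring)
  have hVx : entry V 0 1 *ᵥ x ∈ weightSpace N (k - 2) :=
    hV.entry_mulVec_mem 0 1 hx (by simp [spin]; ring)
  have hDx : entry V 1 1 *ᵥ x ∈ weightSpace N k := hV.entry_mulVec_mem 1 1 hx rfl
  have hDx' : entry U 1 1 *ᵥ x ∈ weightSpace N k := hU.entry_mulVec_mem 1 1 hx rfl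
  have hAVx := hU.entry_mulVec_mem 0 0 hVx rfl
  have hDVx := hU.entry_mulVec_mem 1 1 hVx rfl
  have hBDx : entry U 0 1 *ᵥ entry V 1 1 *ᵥ x ∈ weightSpace N (k - 2) :=
    hU.entry_mulVec_mem 0 1 hDx (by simp [spin]; ring)
  have e : θ - η * ((k : ℂ) - 2) = τ + η := by linear_combination hτ
  have := congrArg (fun M => block M 1 0 1 1 *ᵥ x) h
  simp [block_mul, block_on1, block_on2, block_rop, block_ropHat, Fin.sum_univ_two,
    ← Matrix.mulVec_mulVec, wDiag, wSwap, sz, Matrix.add_mulVec,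
    paramOp_mulVec _ _ _ hx,
    paramOp_mulVec _ _ _ hUx, paramOp_mulVec _ _ _ hVx, paramOp_mulVec _ _ _ hDx,
    paramOp_mulVec _ _ _ hDx', paramOp_mulVec _ _ _ hAVx, paramOp_mulVec _ _ _ hBDx,
    paramOp_mulVec _ _ _ hDVx,
    Matrix.mulVec_smul, smul_smul, e] at this
  rw [show τ + η - (v - u) = τ + η + (u - v) by ring,
    show τ + η - (-v + -u) = τ + η + (u + v) by ring] at this
  rw [add_sub_cancel_right]
  ext s
  have hs := congrFun this s
  simp only [Pi.add_apply, Pi.smul_apply, smul_eq_mul] at hs ⊢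
  linear_combination hs

/-- Exchange relation of `A₋(u)` and `B₋(v)`. -/
theorem exchange_AB (h : Reflection η (chainParam η θ) v u V U) (hU : Graded U) (hV : Graded V)
    (hx : x ∈ weightSpace N k) (hτ : θ - η * k = τ - η) (h1 : sinh τ ≠ 0)
    (h2 : sinh (τ - η) ≠ 0) (h3 : sinh (τ - η - η) ≠ 0) (hv : sinh (2 * v + η) ≠ 0)
    (huv : sinh (u + v + η) ≠ 0) (hd : sinh (v - u) ≠ 0) :
    entry U 0 0 *ᵥ (entry V 0 1 *ᵥ x) =
      exA η u v • (entry V 0 1 *ᵥ (entry U 0 0 *ᵥ x)) +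
      exAA η u v τ • (entry U 0 1 *ᵥ (entry V 0 0 *ᵥ x)) +
      exAE η u v τ • (entry U 0 1 *ᵥ (companion η θ v V *ᵥ x)) := by
  have hr := reflection_AB h hU hV hx hτ
  rw [entry_one_one_mulVec hV hx hτ h1 h2 hv, Matrix.mulVec_add, Matrix.mulVec_smul,
    Matrix.mulVec_smul] at hr
  have i1 := exA_identity_wanted h2 huv hd
  have i2 := exA_identity_from_A h1 h2 hv hd
  have i3 := exA_identity_from_E h1 h2 huv hd
  have hc : sinh (u + v + η) * (sinh (v - u) * sinh (τ - η - η) / sinh (τ - η)) ≠ 0 :=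
    mul_ne_zero huv (div_ne_zero (mul_ne_zero hd h3) h2)
  -- Both sides are multiplied by the coefficient that `A(u) B(v)` carries in the reflection
  -- relation; the claim then follows linearly from that relation and the three coefficient
  -- identities.
  refine smul_right_injective _ hc ?_
  simp only
  rw [← sub_eq_zero] at i1 i2 i3 hr ⊢
  ext s
  have hs := congrFun hr s
  simp only [Pi.sub_apply, Pi.add_apply, Pi.smul_apply, smul_eq_mul, Pi.zero_apply] at hs ⊢
  linear_combination -hs + (entry V 0 1 *ᵥ (entry U 0 0 *ᵥ x)) s * i1 -
    (entry U 0 1 *ᵥ (entry V 0 0 *ᵥ x)) s * i2 -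
    (entry U 0 1 *ᵥ (companion η θ v V *ᵥ x)) s * i3

/-- Exchange relation of the companion of `A₋(u)` and `B₋(v)`. -/
theorem exchange_EB (h : Reflection η (chainParam η θ) u v U V)
    (h' : Reflection η (chainParam η θ) v u V U) (hU : Graded U) (hV : Graded V)
    (hx : x ∈ weightSpace N k) (hτ : θ - η * k = τ - η) (h1 : sinh τ ≠ 0)
    (h2 : sinh (τ - η) ≠ 0) (h3 : sinh (τ - η - η) ≠ 0) (h4 : sinh (τ + η) ≠ 0)
    (h5 : sinh (τ + η + η) ≠ 0) (hu : sinh (2 * u + η) ≠ 0) (hv : sinh (2 * v + η) ≠ 0)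
    (huv : sinh (u + v + η) ≠ 0) (hs : sinh (u + v) ≠ 0) (hd : sinh (u - v) ≠ 0) :
    companion η θ u U *ᵥ (entry V 0 1 *ᵥ x) =
      exE η u v • (entry V 0 1 *ᵥ (companion η θ u U *ᵥ x)) +
      exEA η u v τ • (entry U 0 1 *ᵥ (entry V 0 0 *ᵥ x)) +
      exEE η u v τ • (entry U 0 1 *ᵥ (companion η θ v V *ᵥ x)) := by
  have hd' : sinh (v - u) ≠ 0 := by
    rw [← neg_sub, Complex.sinh_neg]; exact neg_ne_zero.2 hd
  have huv' : sinh (v + u + η) ≠ 0 := by rwa [add_comm v u]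
  have hVx : entry V 0 1 *ᵥ x ∈ weightSpace N (k - 2) :=
    hV.entry_mulVec_mem 0 1 hx (by simp [spin]; ring)
  have e : θ - η * ((k - 2 : ℤ) : ℂ) = τ + η := by push_cast; linear_combination hτ
  have hr := reflection_DB h hU hV hx hτ
  -- The `D`-`B` relation also contains `A(u) B(v)` and `A(v) B(u)`. Both must be reordered, which
  -- is why the reflection equation is needed in both orders of `u` and `v`; `a3` and `a4` then
  -- eliminate `D₋`.
  have a1 := exchange_AB h' hU hV hx hτ h1 h2 h3 hv huv hd'
  have a2 := exchange_AB h hV hU hx hτ h1 h2 h3 hu huv' hd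
  have a3 := congrArg (entry U 0 1 *ᵥ ·) (entry_one_one_mulVec hV hx hτ h1 h2 hv)
  have a4 := congrArg (entry V 0 1 *ᵥ ·) (entry_one_one_mulVec hU hx hτ h1 h2 hu)
  simp only [Matrix.mulVec_add, Matrix.mulVec_smul] at a3 a4
  have i1 := exE_identity_cancel h1 h4 hu huv hd
  have i2 := exE_identity_wanted h1 h4 hu huv hd
  have i3 := exE_identity_from_A (u := u) h1 h4 hv huv hd'
  have i4 := exE_identity_from_E (u := u) h1 h4 hv huv hd'
  have hc : sinh (u - v) * sinh (τ + η + η) / sinh (τ + η) *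
        (sinh (u + v) * sinh (τ + η - η) / sinh (τ + η)) ≠ 0 := by
    rw [add_sub_cancel_right]
    exact mul_ne_zero (div_ne_zero (mul_ne_zero hd h5) h4) (div_ne_zero (mul_ne_zero hs h1) h4)
  refine smul_right_injective _ hc ?_
  simp only
  rw [companion_mulVec hU hVx, e]
  ext s
  have hs := congrFun hr s
  have a1s := congrFun a1 s
  have a2s := congrFun a2 s
  have a3s := congrFun a3 s
  have a4s := congrFun a4 s
  simp only [Pi.sub_apply, Pi.add_apply, Pi.smul_apply, smul_eq_mul] at *
  rw [a1s, a2s, a3s, a4s] at hs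
  rw [a1s]
  linear_combination (sinh (τ + η + η) * sinh (2 * u + η) / sinh (τ + η)) * hs +
    (entry V 0 1 *ᵥ (entry U 0 0 *ᵥ x)) s * i1 +
    (entry V 0 1 *ᵥ (companion η θ u U *ᵥ x)) s * i2 +
    (entry U 0 1 *ᵥ (entry V 0 0 *ᵥ x)) s * i3 +
    (entry U 0 1 *ᵥ (companion η θ v V *ᵥ x)) s * i4

end Exchange

/-! ### Compatibility of the exchange coefficients for two roots. -/

section Cocycle

variable {η u v w τ : ℂ}

/-- Three routes lead to the unwanted term of an old root `w` when a root `v` is added. Their sum is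
the coefficient of `w` without `v`, with shifted parameter, times the factor by which `v` dresses
`w`. The argument `τ - 2η` belongs to the vector with one root fewer. The other three identities
play the same role for the remaining pairs of `A` and `E`. -/
theorem exAA_cocycle (h1 : sinh τ ≠ 0) (h2 : sinh (τ - 2 * η) ≠ 0) (hv : sinh (2 * v + η) ≠ 0)
    (hw : sinh (2 * w + η) ≠ 0) (huv : sinh (u + v + η) ≠ 0) (huv' : sinh (u - v) ≠ 0)
    (huw : sinh (w - u) ≠ 0) (hvw : sinh (v + w + η) ≠ 0) (hvw' : sinh (w - v) ≠ 0) :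
    exA η u v * exAA η u w (τ - 2 * η) + exAA η u v τ * exAA η v w (τ - 2 * η) +
      exAE η u v τ * exEA η v w (τ - 2 * η) = exAA η u w τ * exA η w v := by
  rw [exA, exAA, exAA, exAA, exAE, exEA, exAA, exA,
    show sinh (v - u) = -sinh (u - v) by rw [← Complex.sinh_neg]; ring_nf,
    show w + v + η = v + w + η by ring]
  generalize hx : sinh (2 * v + η) = x at *
  generalize hy : sinh (2 * w + η) = y at *
  generalize hz : sinh (τ - 2 * η) = z at *
  field_simp
  subst hx hy hz
  simp only [Complex.sinh, two_mul, mul_two, neg_add, sub_eq_add_neg, Complex.exp_add,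
    Complex.exp_neg, neg_neg]
  field_simp [Complex.exp_ne_zero]
  ring

theorem exAE_cocycle (h1 : sinh τ ≠ 0) (h2 : sinh (τ - 2 * η) ≠ 0) (hv : sinh (2 * v + η) ≠ 0)
    (hw : sinh (2 * w + η) ≠ 0) (huv : sinh (u + v + η) ≠ 0) (huv' : sinh (u - v) ≠ 0)
    (huw : sinh (u + w + η) ≠ 0) (hvw : sinh (v + w + η) ≠ 0) (hvw' : sinh (w - v) ≠ 0) :
    exA η u v * exAE η u w (τ - 2 * η) + exAA η u v τ * exAE η v w (τ - 2 * η) +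
      exAE η u v τ * exEE η v w (τ - 2 * η) = exAE η u w τ * exE η w v := by
  rw [exA, exAE, exAA, exAE, exAE, exEE, exAE, exE,
    show sinh (v - u) = -sinh (u - v) by rw [← Complex.sinh_neg]; ring_nf,
    show w + v + η = v + w + η by ring]
  generalize hx : sinh (2 * v + η) = x at *
  generalize hy : sinh (2 * w + η) = y at *
  generalize hz : sinh (τ - 2 * η) = z at *
  field_simp
  subst hx hy hz
  simp only [Complex.sinh, two_mul, mul_two, neg_add, sub_eq_add_neg, Complex.exp_add,
    Complex.exp_neg, neg_neg]
  field_simp [Complex.exp_ne_zero]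
  ring

theorem exEA_cocycle (h1 : sinh τ ≠ 0) (h2 : sinh (τ - 2 * η) ≠ 0) (hv : sinh (2 * v + η) ≠ 0)
    (hw : sinh (2 * w + η) ≠ 0) (huv : sinh (u + v + η) ≠ 0) (huv' : sinh (u - v) ≠ 0)
    (huw : sinh (u + w + η) ≠ 0) (hvw : sinh (v + w + η) ≠ 0) (hvw' : sinh (w - v) ≠ 0) :
    exE η u v * exEA η u w (τ - 2 * η) + exEA η u v τ * exAA η v w (τ - 2 * η) +
      exEE η u v τ * exEA η v w (τ - 2 * η) = exEA η u w τ * exA η w v := by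
  rw [exE, exEA, exEA, exAA, exEE, exEA, exEA, exA,
    show sinh (v - u) = -sinh (u - v) by rw [← Complex.sinh_neg]; ring_nf,
    show w + v + η = v + w + η by ring]
  generalize hx : sinh (2 * v + η) = x at *
  generalize hy : sinh (2 * w + η) = y at *
  generalize hz : sinh (τ - 2 * η) = z at *
  field_simp
  subst hx hy hz
  simp only [Complex.sinh, two_mul, mul_two, neg_add, sub_eq_add_neg, Complex.exp_add,
    Complex.exp_neg, neg_neg]
  field_simp [Complex.exp_ne_zero]
  ring

theorem exEE_cocycle (h1 : sinh τ ≠ 0) (h2 : sinh (τ - 2 * η) ≠ 0) (hv : sinh (2 * v + η) ≠ 0)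
    (hw : sinh (2 * w + η) ≠ 0) (huv : sinh (u + v + η) ≠ 0) (huv' : sinh (u - v) ≠ 0)
    (huw : sinh (w - u) ≠ 0) (hvw : sinh (v + w + η) ≠ 0) (hvw' : sinh (w - v) ≠ 0) :
    exE η u v * exEE η u w (τ - 2 * η) + exEA η u v τ * exAE η v w (τ - 2 * η) +
      exEE η u v τ * exEE η v w (τ - 2 * η) = exEE η u w τ * exE η w v := by
  rw [exE, exEE, exEA, exAE, exEE, exEE, exEE, exE,
    show sinh (v - u) = -sinh (u - v) by rw [← Complex.sinh_neg]; ring_nf,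
    show w + v + η = v + w + η by ring]
  generalize hx : sinh (2 * v + η) = x at *
  generalize hy : sinh (2 * w + η) = y at *
  generalize hz : sinh (τ - 2 * η) = z at *
  field_simp
  subst hx hy hz
  simp only [Complex.sinh, two_mul, mul_two, neg_add, sub_eq_add_neg, Complex.exp_add,
    Complex.exp_neg, neg_neg]
  field_simp [Complex.exp_ne_zero]
  ring

end Cocycle

/-! ### The Bethe ansatz for abstract operators. -/

section OffShell

variable {V I : Type*} [AddCommGroup V] [Module ℂ V] [DecidableEq I]

/-- Off-shell eigenvalue of `A₋(u)` or of its companion. -/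
def dressed (ex : ℂ → ℂ → ℂ) (r : ℂ → ℂ) (v : I → ℂ) (S : Finset I) (u : ℂ) : ℂ :=
  r u * ∏ k ∈ S, ex u (v k)

theorem dressed_insert (ex : ℂ → ℂ → ℂ) (r : ℂ → ℂ) (v : I → ℂ) {S : Finset I} {a : I}
    (ha : a ∉ S) (u : ℂ) :
    dressed ex r v (insert a S) u = ex u (v a) * dressed ex r v S u := by
  rw [dressed, dressed, Finset.prod_insert ha]; ring

/-- Parameters at which the exchange relations of the double row operators hold. -/
structure GenericPair (η u v : ℂ) : Prop where
  left : sinh (2 * u + η) ≠ 0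
  right : sinh (2 * v + η) ≠ 0
  add_eta : sinh (u + v + η) ≠ 0
  add : sinh (u + v) ≠ 0
  sub : sinh (u - v) ≠ 0
  sub_eta : sinh (u - v + η) ≠ 0

theorem sinh_sub_ne_zero_comm {a b : ℂ} (h : sinh (a - b) ≠ 0) : sinh (b - a) ≠ 0 := by
  rw [← neg_sub, Complex.sinh_neg]; exact neg_ne_zero.2 h

/-- One step of the algebraic Bethe ansatz. -/
theorem offShell_step {X A E : V →ₗ[ℂ] V} {Bu Ba : V →ₗ[ℂ] V} {Φ : Finset I → V}
    {S : Finset I} {a : I} (ha : a ∉ S) {f p q l l1 l2 : ℂ} {c c1 c2 C : I → ℂ}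
    (hx : X (Ba (Φ S)) = f • Ba (X (Φ S)) + p • Bu (A (Φ S)) + q • Bu (E (Φ S)))
    (hΦ : ∀ T ⊆ S, Φ (insert a T) = Ba (Φ T))
    (hB : ∀ T ⊆ S, Bu (Ba (Φ T)) = Ba (Bu (Φ T)))
    (hX : X (Φ S) = l • Φ S + ∑ i ∈ S, c i • Bu (Φ (S.erase i)))
    (hA : A (Φ S) = l1 • Φ S + ∑ i ∈ S, c1 i • Ba (Φ (S.erase i)))
    (hE : E (Φ S) = l2 • Φ S + ∑ i ∈ S, c2 i • Ba (Φ (S.erase i)))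
    (hC : ∀ i ∈ S, f * c i + p * c1 i + q * c2 i = C i) (hCa : C a = p * l1 + q * l2) :
    X (Φ (insert a S)) = (f * l) • Φ (insert a S) +
      ∑ i ∈ insert a S, C i • Bu (Φ ((insert a S).erase i)) := by
  have h1 : ∀ i ∈ S, (insert a S).erase i = insert a (S.erase i) := fun i hi =>
    Finset.erase_insert_of_ne (fun h => ha (h ▸ hi))
  rw [Finset.sum_insert ha, Finset.erase_insert ha, hΦ S subset_rfl, hx, hX, hA, hE, hCa]
  -- Commutativity of the creation operators lets all three families of unwanted terms be written on
  -- the same vectors, so that their coefficients can be added.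
  have h2 : ∑ i ∈ S, C i • Bu (Φ ((insert a S).erase i)) =
      f • ∑ i ∈ S, c i • Ba (Bu (Φ (S.erase i))) +
      p • ∑ i ∈ S, c1 i • Bu (Ba (Φ (S.erase i))) +
      q • ∑ i ∈ S, c2 i • Bu (Ba (Φ (S.erase i))) := by
    simp only [Finset.smul_sum, ← Finset.sum_add_distrib]
    refine Finset.sum_congr rfl fun i hi => ?_
    rw [h1 i hi, hΦ _ (Finset.erase_subset _ _), ← hB _ (Finset.erase_subset _ _), ← hC i hi]
    module
  rw [h2]
  simp only [map_add, map_sum, map_smul]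
  module

/-- The off-shell action of `A₋(u)` and of its companion on Bethe vectors. -/
theorem offShell {A E B : ℂ → V →ₗ[ℂ] V} {Φ : Finset I → V} {η : ℂ} {τ : ℕ → ℂ} {rA rE : ℂ → ℂ}
    {v : I → ℂ} {P : ℂ → Prop}
    (hτ : ∀ m, τ (m + 1) = τ m + 2 * η) (hτ0 : ∀ S : Finset I, sinh (τ S.card) ≠ 0)
    (hA0 : ∀ u, A u (Φ ∅) = rA u • Φ ∅) (hE0 : ∀ u, P u → E u (Φ ∅) = rE u • Φ ∅)
    (hΦ : ∀ S a, a ∉ S → Φ (insert a S) = B (v a) (Φ S))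
    (hB : ∀ u p S, P u → P p → GenericPair η u p → B u (B p (Φ S)) = B p (B u (Φ S)))
    (hA : ∀ u p S, P u → P p → GenericPair η u p → A u (B p (Φ S)) = exA η u p • B p (A u (Φ S)) +
      exAA η u p (τ (S.card + 1)) • B u (A p (Φ S)) +
      exAE η u p (τ (S.card + 1)) • B u (E p (Φ S)))
    (hE : ∀ u p S, P u → P p → GenericPair η u p → E u (B p (Φ S)) = exE η u p • B p (E u (Φ S)) +
      exEA η u p (τ (S.card + 1)) • B u (A p (Φ S)) +
      exEE η u p (τ (S.card + 1)) • B u (E p (Φ S)))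
    (hv : ∀ i j, i ≠ j → GenericPair η (v i) (v j)) (hP : ∀ i, P (v i)) (S : Finset I) :
    ∀ u, P u → (∀ i ∈ S, GenericPair η u (v i)) →
      A u (Φ S) = dressed (exA η) rA v S u • Φ S +
          ∑ i ∈ S, (exAA η u (v i) (τ S.card) * dressed (exA η) rA v (S.erase i) (v i) +
            exAE η u (v i) (τ S.card) * dressed (exE η) rE v (S.erase i) (v i)) •
              B u (Φ (S.erase i)) ∧
      E u (Φ S) = dressed (exE η) rE v S u • Φ S +
          ∑ i ∈ S, (exEA η u (v i) (τ S.card) * dressed (exA η) rA v (S.erase i) (v i) +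
            exEE η u (v i) (τ S.card) * dressed (exE η) rE v (S.erase i) (v i)) •
              B u (Φ (S.erase i)) := by
  induction S using Finset.induction_on with
  | empty => intro u hu _; simp [dressed, hA0, hE0 u hu]
  | insert a S ha ih =>
    intro u hPu hu
    have hua := hu a (Finset.mem_insert_self _ _)
    have hui : ∀ i ∈ S, GenericPair η u (v i) := fun i hi => hu i (Finset.mem_insert_of_mem hi)
    have hne : ∀ i ∈ S, a ≠ i := fun i hi h => ha (h ▸ hi)
    have ihu := ih u hPu hui
    -- The exchange relation also produces `A` and `E` at the new root itself, so the induction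
    -- hypothesis is needed at `v a` as well as at `u`.
    have iha := ih (v a) (hP a) fun i hi => hv a i (hne i hi)
    have hΦ' : ∀ T ⊆ S, Φ (insert a T) = B (v a) (Φ T) := fun T hT => hΦ T a fun h => ha (hT h)
    have hB' : ∀ T ⊆ S, B u (B (v a) (Φ T)) = B (v a) (B u (Φ T)) := fun T _ =>
      hB u (v a) T hPu (hP a) hua
    have ht1 : sinh (τ (S.card + 1)) ≠ 0 := by
      rw [← Finset.card_insert_of_notMem ha]; exact hτ0 _
    have ht2 : sinh (τ (S.card + 1) - 2 * η) ≠ 0 := by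
      rw [hτ, add_sub_cancel_right]; exact hτ0 S
    have ht : τ S.card = τ (S.card + 1) - 2 * η := by rw [hτ, add_sub_cancel_right]
    rw [ht] at ihu iha
    have her : ∀ i ∈ S, (insert a S).erase i = insert a (S.erase i) := fun i hi =>
      Finset.erase_insert_of_ne (hne i hi)
    have hni : ∀ i, a ∉ S.erase i := fun i h => ha (Finset.erase_subset _ _ h)
    constructor
    · rw [dressed_insert _ _ _ ha, Finset.card_insert_of_notMem ha]
      refine offShell_step ha (hA u (v a) S hPu (hP a) hua) hΦ' hB' ihu.1 iha.1 iha.2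
        (fun i hi => ?_) (by rw [Finset.erase_insert ha])
      rw [her i hi, dressed_insert _ _ _ (hni i), dressed_insert _ _ _ (hni i)]
      have g1 := hui i hi
      have g2 := hv a i (hne i hi)
      linear_combination
        dressed (exA η) rA v (S.erase i) (v i) * exAA_cocycle ht1 ht2 hua.right g1.right
          hua.add_eta hua.sub (sinh_sub_ne_zero_comm g1.sub) g2.add_eta
          (sinh_sub_ne_zero_comm g2.sub) +
        dressed (exE η) rE v (S.erase i) (v i) * exAE_cocycle ht1 ht2 hua.right g1.right
          hua.add_eta hua.sub g1.add_eta g2.add_eta (sinh_sub_ne_zero_comm g2.sub)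
    · rw [dressed_insert _ _ _ ha, Finset.card_insert_of_notMem ha]
      refine offShell_step ha (hE u (v a) S hPu (hP a) hua) hΦ' hB' ihu.2 iha.1 iha.2
        (fun i hi => ?_) (by rw [Finset.erase_insert ha])
      rw [her i hi, dressed_insert _ _ _ (hni i), dressed_insert _ _ _ (hni i)]
      have g1 := hui i hi
      have g2 := hv a i (hne i hi)
      linear_combination
        dressed (exA η) rA v (S.erase i) (v i) * exEA_cocycle ht1 ht2 hua.right g1.right
          hua.add_eta hua.sub g1.add_eta g2.add_eta (sinh_sub_ne_zero_comm g2.sub) +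
        dressed (exE η) rE v (S.erase i) (v i) * exEE_cocycle ht1 ht2 hua.right g1.right
          hua.add_eta hua.sub (sinh_sub_ne_zero_comm g1.sub) g2.add_eta
          (sinh_sub_ne_zero_comm g2.sub)

end OffShell

/-! ### Bethe vectors of the spin chain. -/

section Chain

variable {N M : ℕ} {η θ δ ζ : ℂ} {ξ : Fin N → ℂ} {v : Fin M → ℂ}

/-- Commutation of the creation operators. -/
theorem Bminus_commute {u p : ℂ} (hθ : θ = δ - ζ) (hδu : sinh (δ + u) ≠ 0)
    (hζu : sinh (ζ + u) ≠ 0) (hδp : sinh (δ + p) ≠ 0) (hζp : sinh (ζ + p) ≠ 0)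
    (hgen : ∀ k : ℤ, |k| ≤ N + 4 → sinh (θ - η * k) ≠ 0)
    (h1 : sinh (u + p) ≠ 0) (h2 : sinh (u - p + η) ≠ 0) :
    Commute (Bminus η θ δ ζ ξ u) (Bminus η θ δ ζ ξ p) := by
  have hr := reflection_doubleRow hθ hδu hζu hδp hζp (N := N)
    (fun k hk => hgen k (hk.trans (by omega))) ξ
  refine Matrix.ext_of_mulVec_single fun s => ?_
  rw [← Matrix.mulVec_mulVec, ← Matrix.mulVec_mulVec]
  have hx : (Pi.single s 1 : Config N → ℂ) ∈ weightSpace N (weight s) := by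
    intro t ht
    by_contra h
    exact ht (Pi.single_eq_of_ne (fun h' => h (by rw [h'])) _)
  have hw := abs_le.1 (abs_weight_le s)
  have hs : ∀ j : ℤ, |j| ≤ 4 → sinh (θ - η * weight s + η * j) ≠ 0 := fun j hj => by
    have h := abs_le.1 hj
    have := hgen (weight s - j) (abs_le.2 ⟨by omega, by omega⟩)
    convert this using 2
    push_cast; ring
  have := reflection_BB hr (graded_doubleRow _ _ _ _ _ _) (graded_doubleRow _ _ _ _ _ _) hx
    (τ := θ - η * weight s + η) (by ring)
  -- The two scalars agree up to the order of their factors, and this common nonzero scalar can be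
  -- cancelled.
  rw [mul_comm] at this
  refine smul_right_injective _ (mul_ne_zero h2 (div_ne_zero (mul_ne_zero h1 ?_) ?_)) this
  · convert hs 1 (by norm_num) using 2; push_cast; ring
  · convert hs 2 (by norm_num) using 2; push_cast; ring

/-- The Bethe vector attached to a subset of the Bethe roots. -/
def betheVec (η θ δ ζ : ℂ) (ξ : Fin N → ℂ) (v : Fin M → ℂ) (S : Finset (Fin M)) :
    Config N → ℂ :=
  (((List.finRange M).filter (· ∈ S)).map fun i => Bminus η θ δ ζ ξ (v i)).prod *ᵥ refState N

theorem betheVec_univ : betheVec η θ δ ζ ξ v Finset.univ = betheState η θ δ ζ ξ v := by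
  simp [betheVec, betheState, List.ofFn_eq_map]

theorem betheVec_empty : betheVec η θ δ ζ ξ v ∅ = refState N := by
  simp [betheVec]

/-- Since the creation operators commute, the ordered product is a `Finset.noncommProd`, and any
root may be taken out first. -/
theorem betheVec_insert (hcomm : ∀ i j, i ≠ j →
      Commute (Bminus η θ δ ζ ξ (v i)) (Bminus η θ δ ζ ξ (v j))) {S : Finset (Fin M)} {a : Fin M}
    (ha : a ∉ S) :
    betheVec η θ δ ζ ξ v (insert a S) =
      Bminus η θ δ ζ ξ (v a) *ᵥ betheVec η θ δ ζ ξ v S := by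
  have hpair : ∀ S : Finset (Fin M), (S : Set (Fin M)).Pairwise
      (Function.onFun Commute fun i => Bminus η θ δ ζ ξ (v i)) :=
    fun S i _ j _ h => hcomm i j h
  have hl : ∀ S : Finset (Fin M),
      (((List.finRange M).filter (· ∈ S)).map fun i => Bminus η θ δ ζ ξ (v i)).prod =
      S.noncommProd (fun i => Bminus η θ δ ζ ξ (v i)) (hpair S) := by
    intro S
    have hS : ((List.finRange M).filter (· ∈ S)).toFinset = S := by ext; simp
    have := Finset.noncommProd_toFinset ((List.finRange M).filter (· ∈ S))
      (fun i => Bminus η θ δ ζ ξ (v i)) (hpair _)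
      ((List.nodup_finRange M).filter _)
    rw [← this]
    exact Finset.noncommProd_congr hS (fun _ _ => rfl) _
  rw [betheVec, betheVec, hl, hl, Finset.noncommProd_insert_of_notMem _ _ _ _ ha,
    Matrix.mulVec_mulVec]

theorem refState_mem : refState N ∈ weightSpace N N := by
  intro s hs
  rw [weight_eq_iff]
  by_contra h
  exact hs (Pi.single_eq_of_ne h _)

theorem Bminus_mulVec_mem (u : ℂ) {k : ℤ} {x : Config N → ℂ} (hx : x ∈ weightSpace N k) :
    Bminus η θ δ ζ ξ u *ᵥ x ∈ weightSpace N (k - 2) :=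
  (graded_doubleRow η θ δ ζ ξ u).entry_mulVec_mem 0 1 hx (by simp [spin]; ring)

theorem list_Bminus_mem (l : List ℂ) :
    (l.map (Bminus η θ δ ζ ξ)).prod *ᵥ refState N ∈ weightSpace N (N - 2 * l.length) := by
  induction l with
  | nil => simpa using refState_mem
  | cons u l ih =>
    rw [List.map_cons, List.prod_cons, ← Matrix.mulVec_mulVec]
    convert Bminus_mulVec_mem u ih using 2
    push_cast [List.length_cons]; ring

theorem betheVec_mem (S : Finset (Fin M)) :
    betheVec η θ δ ζ ξ v S ∈ weightSpace N (N - 2 * S.card) := by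
  have h := list_Bminus_mem (η := η) (θ := θ) (δ := δ) (ζ := ζ) (ξ := ξ)
    (((List.finRange M).filter (· ∈ S)).map v)
  have hc : ((List.finRange M).filter (· ∈ S)).length = S.card := by
    rw [← List.toFinset_card_of_nodup ((List.nodup_finRange M).filter _)]
    congr 1; ext; simp
  rwa [List.map_map, List.length_map, hc] at h

/-- Only the all-up configuration has the maximal spin, so this weight space is a line. -/
theorem eq_smul_refState {x : Config N → ℂ} (hx : x ∈ weightSpace N N) :
    x = x (fun _ => 0) • refState N := by
  ext s
  by_cases h : s = fun _ => 0
  · subst h; simp [refState]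
  · have : x s = 0 := by
      by_contra h'
      exact h ((weight_eq_iff s).1 (hx s h'))
    simp [refState, this, h]

theorem entry_mulVec_refState (X : AuxOp N) (a b : Fin 2) :
    (entry X a b *ᵥ refState N) (fun _ => 0) = X (a, fun _ => 0) (b, fun _ => 0) := by
  simp [refState, entry]

theorem entry_zero_zero_refState (u : ℂ) :
    entry (doubleRow η θ δ ζ ξ u) 0 0 *ᵥ refState N = refA η δ ξ u • refState N := by
  rw [eq_smul_refState ((graded_doubleRow η θ δ ζ ξ u).entry_mulVec_mem 0 0 refState_mem rfl),
    entry_mulVec_refState, doubleRow_ref_zero]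

theorem entry_one_one_refState (u : ℂ) :
    entry (doubleRow η θ δ ζ ξ u) 1 1 *ᵥ refState N =
      doubleRow η θ δ ζ ξ u (1, fun _ => 0) (1, fun _ => 0) • refState N := by
  rw [eq_smul_refState ((graded_doubleRow η θ δ ζ ξ u).entry_mulVec_mem 1 1 refState_mem rfl),
    entry_mulVec_refState]

theorem companion_refState {u : ℂ} (hθ : θ = δ - ζ)
    (h : ∀ k : ℤ, |k| ≤ N → sinh (θ - η * k) ≠ 0) (hδu : sinh (δ + u) ≠ 0)
    (hζu : sinh (ζ + u) ≠ 0) :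
    companion η θ u (doubleRow η θ δ ζ ξ u) *ᵥ refState N = refE η δ ζ ξ u • refState N := by
  have h0 : sinh (θ - η * N) ≠ 0 := by simpa using h N (by simp)
  have := doubleRow_ref_one hθ h ξ hδu hζu
  rw [companion_mulVec (graded_doubleRow η θ δ ζ ξ u) refState_mem, entry_zero_zero_refState,
    entry_one_one_refState, smul_smul, smul_smul, ← sub_smul, Int.cast_natCast]
  congr 1
  field_simp
  linear_combination this

/-- The off-shell action of the diagonal entries on Bethe vectors. -/
theorem offShell_doubleRow (hθ : θ = δ - ζ)
    (hgen : ∀ k : ℤ, |k| ≤ N + 2 * M + 5 → sinh (θ - η * k) ≠ 0)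
    (hK : ∀ i, sinh (δ + v i) ≠ 0 ∧ sinh (ζ + v i) ≠ 0)
    (hv : ∀ i j, i ≠ j → GenericPair η (v i) (v j)) {u : ℂ} (hδu : sinh (δ + u) ≠ 0)
    (hζu : sinh (ζ + u) ≠ 0) (hu : ∀ i, GenericPair η u (v i)) {τ : ℂ}
    (hτ : τ = θ - η * (N - 2 * M) - η) :
    entry (doubleRow η θ δ ζ ξ u) 0 0 *ᵥ betheState η θ δ ζ ξ v =
        dressed (exA η) (refA η δ ξ) v Finset.univ u • betheState η θ δ ζ ξ v +
          ∑ i, (exAA η u (v i) τ *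
              dressed (exA η) (refA η δ ξ) v (Finset.univ.erase i) (v i) +
            exAE η u (v i) τ * dressed (exE η) (refE η δ ζ ξ) v (Finset.univ.erase i) (v i)) •
              (Bminus η θ δ ζ ξ u *ᵥ betheVec η θ δ ζ ξ v (Finset.univ.erase i)) ∧
      companion η θ u (doubleRow η θ δ ζ ξ u) *ᵥ betheState η θ δ ζ ξ v =
        dressed (exE η) (refE η δ ζ ξ) v Finset.univ u • betheState η θ δ ζ ξ v +
          ∑ i, (exEA η u (v i) τ *
              dressed (exA η) (refA η δ ξ) v (Finset.univ.erase i) (v i) +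
            exEE η u (v i) τ * dressed (exE η) (refE η δ ζ ξ) v (Finset.univ.erase i) (v i)) •
              (Bminus η θ δ ζ ξ u *ᵥ betheVec η θ δ ζ ξ v (Finset.univ.erase i)) := by
  set P : ℂ → Prop := fun u => sinh (δ + u) ≠ 0 ∧ sinh (ζ + u) ≠ 0 with hP
  have hcomm : ∀ u p, P u → P p → GenericPair η u p →
      Commute (Bminus η θ δ ζ ξ u) (Bminus η θ δ ζ ξ p) := fun u p h1 h2 h =>
    Bminus_commute hθ h1.1 h1.2 h2.1 h2.2 (fun k hk => hgen k (hk.trans (by omega))) h.add h.sub_eta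
  have hN : ∀ k : ℤ, |k| ≤ N → sinh (θ - η * k) ≠ 0 := fun k hk => hgen k (hk.trans (by omega))
  set t : ℕ → ℂ := fun m => θ - η * (N - 2 * m) - η with ht
  -- For `τ = t (S.card + 1)` the shifts `j = 0, …, 4` give `τ - 2η, …, τ + 2η`, which cover all the
  -- arguments required by the exchange relations.
  have htj : ∀ (S : Finset (Fin M)) (j : ℤ), |j| ≤ 4 → sinh (t S.card + η * j) ≠ 0 := by
    intro S j hj
    have h1 := abs_le.1 hj
    have h2 : S.card ≤ M := by simpa using Finset.card_le_univ S
    have := hgen (N - 2 * S.card + 1 - j) (abs_le.2 ⟨by omega, by omega⟩)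
    convert this using 2
    simp only [ht]; push_cast; ring
  have hr : ∀ u p, P u → P p → Reflection η (chainParam η θ) u p (doubleRow η θ δ ζ ξ u)
      (doubleRow η θ δ ζ ξ p) := fun u p h1 h2 =>
    reflection_doubleRow hθ h1.1 h1.2 h2.1 h2.2 hN ξ
  have hg := fun u => graded_doubleRow η θ δ ζ ξ u
  have hsub : ∀ S : Finset (Fin M), θ - η * ((N - 2 * S.card : ℤ) : ℂ) = t (S.card + 1) - η := by
    intro S; simp only [ht]; push_cast; ring
  have hts : ∀ S : Finset (Fin M), t (S.card + 1) = t S.card + 2 * η := by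
    intro S; simp only [ht]; push_cast; ring
  have main := offShell (A := fun u => (entry (doubleRow η θ δ ζ ξ u) 0 0).mulVecLin)
    (E := fun u => (companion η θ u (doubleRow η θ δ ζ ξ u)).mulVecLin)
    (B := fun u => (Bminus η θ δ ζ ξ u).mulVecLin) (Φ := betheVec η θ δ ζ ξ v)
    (η := η) (τ := t) (rA := refA η δ ξ) (rE := refE η δ ζ ξ) (v := v) (P := P)
    (fun m => by simp only [ht]; push_cast; ring)
    (fun S => by simpa using htj S 0 (by simp))
    (fun u => by simp [betheVec_empty, entry_zero_zero_refState])
    (fun u hu => by simp [betheVec_empty, companion_refState hθ hN hu.1 hu.2])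
    (fun S a ha => betheVec_insert (fun i j hij => hcomm _ _ (hK i) (hK j) (hv i j hij)) ha)
    (fun u p S h1 h2 h => by
      have := hcomm u p h1 h2 h
      simp only [Matrix.mulVecLin_apply, Matrix.mulVec_mulVec, this.eq])
    (fun u p S h1 h2 h => exchange_AB (hr p u h2 h1) (hg u) (hg p) (betheVec_mem S) (hsub S)
      (by rw [hts]; convert htj S 2 (by simp) using 2; push_cast; ring)
      (by rw [hts]; convert htj S 1 (by simp) using 2; push_cast; ring)
      (by rw [hts]; convert htj S 0 (by simp) using 2; push_cast; ring)
      h.right h.add_eta (sinh_sub_ne_zero_comm h.sub))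
    (fun u p S h1 h2 h => exchange_EB (hr u p h1 h2) (hr p u h2 h1) (hg u) (hg p) (betheVec_mem S)
      (hsub S)
      (by rw [hts]; convert htj S 2 (by simp) using 2; push_cast; ring)
      (by rw [hts]; convert htj S 1 (by simp) using 2; push_cast; ring)
      (by rw [hts]; convert htj S 0 (by simp) using 2; push_cast; ring)
      (by rw [hts]; convert htj S 3 (by simp) using 2; push_cast; ring)
      (by rw [hts]; convert htj S 4 (by simp) using 2; push_cast; ring)
      h.left h.right h.add_eta h.add h.sub)
    hv hK Finset.univ u ⟨hδu, hζu⟩ (fun i _ => hu i)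
  have e : t (Finset.univ : Finset (Fin M)).card = τ := by simp [ht, hτ]
  rw [e, betheVec_univ] at main
  exact main

end Chain

/-! ### The transfer matrix and its unwanted terms. -/

section Transfer

variable {N M : ℕ} {η θ δ ζ δ' ζ' u : ℂ} {ξ : Fin N → ℂ} {v : Fin M → ℂ}

theorem transferSOS_mulVec (x : Config N → ℂ) :
    transferSOS η θ δ ζ δ' ζ' ξ u *ᵥ x =
      (sinh (δ' - ζ' - η) / sinh (δ' - ζ') * (sinh (δ' + u + η) / sinh (δ' - u - η))) •
        (entry (doubleRow η θ δ ζ ξ u) 0 0 *ᵥ x) +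
      (sinh (δ' - ζ' + η) / sinh (δ' - ζ') * (sinh (ζ' + u + η) / sinh (ζ' - u - η))) •
        (entry (doubleRow η θ δ ζ ξ u) 1 1 *ᵥ x) := by
  have h : ∀ a, entry (onAux (KplusTilde η δ' ζ' u) * doubleRow η θ δ ζ ξ u) a a =
      KplusTilde η δ' ζ' u a a • entry (doubleRow η θ δ ζ ξ u) a a := by
    intro a
    ext s t
    simp only [entry, Matrix.of_apply, Matrix.mul_apply, onAux, Matrix.kroneckerMap_apply,
      Fintype.sum_prod_type, Matrix.smul_apply, smul_eq_mul, Matrix.one_apply]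
    rw [Finset.sum_eq_single a]
    · simp
    · intro b _ hb
      simp [KplusTilde, Kminus, hb.symm]
    · simp
  rw [transferSOS, traceAux, Fin.sum_univ_two, h, h, Matrix.add_mulVec, Matrix.smul_mulVec,
    Matrix.smul_mulVec]
  simp only [KplusTilde, Kminus, sz, Matrix.diagonal_mul_diagonal, Matrix.diagonal_apply_eq,
    Matrix.cons_val_zero, Matrix.cons_val_one, if_true, one_ne_zero, if_false]
  congr 3 <;> ring_nf

/-- Coefficient of `A₋(u)` in the transfer matrix. -/
def transferA (η δ' ζ' u : ℂ) : ℂ :=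
  sinh (ζ' - u) * sinh (δ' + u) * sinh (2 * u + 2 * η) /
    (sinh (ζ' - u - η) * sinh (δ' - u - η) * sinh (2 * u + η))

/-- Coefficient of the companion of `A₋(u)` in the transfer matrix. -/
def transferE (η ζ' u : ℂ) : ℂ := sinh (ζ' + u + η) / (sinh (2 * u + η) * sinh (ζ' - u - η))

/-- The left side is the total coefficient of `A₋` after `D₋` is rewritten through the companion on
a vector whose dynamical parameter is `δ' - ζ'`. At this value the two contributions combine into a
product. -/
theorem transferA_eq (h0 : sinh (δ' - ζ') ≠ 0) (h1 : sinh (δ' - ζ' + η) ≠ 0)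
    (hδ : sinh (δ' - u - η) ≠ 0) (hζ : sinh (ζ' - u - η) ≠ 0) (hu : sinh (2 * u + η) ≠ 0) :
    sinh (δ' - ζ' - η) / sinh (δ' - ζ') * (sinh (δ' + u + η) / sinh (δ' - u - η)) +
      sinh (δ' - ζ' + η) / sinh (δ' - ζ') * (sinh (ζ' + u + η) / sinh (ζ' - u - η)) *
        (sinh η * sinh (δ' - ζ' + 2 * u + η) / (sinh (δ' - ζ' + η) * sinh (2 * u + η))) =
      transferA η δ' ζ' u := by
  rw [transferA]
  generalize hx : sinh (2 * u + η) = x at *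
  field_simp
  subst hx
  simp only [Complex.sinh, two_mul, mul_two, neg_add, sub_eq_add_neg, Complex.exp_add,
    Complex.exp_neg, neg_neg]
  field_simp [Complex.exp_ne_zero]
  ring

theorem transferE_eq (h0 : sinh (δ' - ζ') ≠ 0) (h1 : sinh (δ' - ζ' + η) ≠ 0) :
    sinh (δ' - ζ' + η) / sinh (δ' - ζ') * (sinh (ζ' + u + η) / sinh (ζ' - u - η)) *
        (sinh (δ' - ζ') / (sinh (δ' - ζ' + η) * sinh (2 * u + η))) =
      transferE η ζ' u := by
  rw [transferE]
  field_simp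

/-- Common factor of the unwanted terms. -/
def unwantedFactor (η δ' ζ' u w : ℂ) : ℂ :=
  sinh η * sinh (2 * u + 2 * η) / (sinh (2 * w + η) * sinh (ζ' - u - η) * sinh (δ' - u - η) *
    sinh (u - w) * sinh (u + w + η))

/-- All dependence on `u` collects in a factor that `unwanted_E` shares with opposite sign. The
condition for cancellation therefore involves only the root `w`. -/
theorem unwanted_A {w : ℂ} (h1 : sinh (δ' - ζ' - η) ≠ 0) (hδ : sinh (δ' - u - η) ≠ 0)
    (hζ : sinh (ζ' - u - η) ≠ 0) (hu : GenericPair η u w) :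
    transferA η δ' ζ' u * exAA η u w (δ' - ζ' - η) + transferE η ζ' u * exEA η u w (δ' - ζ' - η) =
      unwantedFactor η δ' ζ' u w * (sinh (2 * w) * sinh (ζ' - w) * sinh (δ' + w)) := by
  obtain ⟨hu1, hw, huw, -, hd, -⟩ := hu
  rw [transferA, transferE, exAA, exEA, unwantedFactor,
    show sinh (w - u) = -sinh (u - w) by rw [← Complex.sinh_neg]; ring_nf]
  generalize hx : sinh (2 * w + η) = x at *
  generalize hy : sinh (2 * u + η) = y at *
  field_simp
  subst hx hy
  simp only [Complex.sinh, two_mul, neg_add, sub_eq_add_neg, Complex.exp_add,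
    Complex.exp_neg, neg_neg]
  field_simp [Complex.exp_ne_zero]
  ring

theorem unwanted_E {w : ℂ} (h1 : sinh (δ' - ζ' - η) ≠ 0) (hδ : sinh (δ' - u - η) ≠ 0)
    (hζ : sinh (ζ' - u - η) ≠ 0) (hu : GenericPair η u w) :
    transferA η δ' ζ' u * exAE η u w (δ' - ζ' - η) + transferE η ζ' u * exEE η u w (δ' - ζ' - η) =
      -(unwantedFactor η δ' ζ' u w * (sinh (ζ' + w + η) * sinh (δ' - w - η))) := by
  obtain ⟨hu1, hw, huw, -, hd, -⟩ := hu
  rw [transferA, transferE, exAE, exEE, unwantedFactor,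
    show sinh (w - u) = -sinh (u - w) by rw [← Complex.sinh_neg]; ring_nf]
  generalize hx : sinh (2 * w + η) = x at *
  generalize hy : sinh (2 * u + η) = y at *
  field_simp
  subst hx hy
  simp only [Complex.sinh, two_mul, neg_add, sub_eq_add_neg, Complex.exp_add,
    Complex.exp_neg, neg_neg]
  field_simp [Complex.exp_ne_zero]
  ring

/-- Denominator of the unwanted term of a Bethe root. -/
def betheDenom (η δ ζ : ℂ) (v : Fin M → ℂ) (i : Fin M) : ℂ :=
  sinh (δ + v i) * sinh (ζ + v i) *
    ∏ k ∈ Finset.univ.erase i, (sinh (v i + v k + η) * sinh (v i - v k))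

theorem dressed_A_eq_y1 (i : Fin M) (hδ : sinh (δ + v i) ≠ 0) (hζ : sinh (ζ + v i) ≠ 0)
    (hv : ∀ k, k ≠ i → GenericPair η (v i) (v k)) :
    sinh (ζ' - v i) * sinh (δ' + v i) *
        dressed (exA η) (refA η δ ξ) v (Finset.univ.erase i) (v i) =
      y1 η δ ζ δ' ζ' ξ v i (v i) / betheDenom η δ ζ v i := by
  have hp : ∏ k ∈ Finset.univ.erase i, (sinh (v i + v k + η) * sinh (v i - v k)) ≠ 0 :=
    Finset.prod_ne_zero_iff.2 fun k hk =>
      mul_ne_zero (hv k (Finset.ne_of_mem_erase hk)).add_eta (hv k (Finset.ne_of_mem_erase hk)).sub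
  have e : ∏ k ∈ Finset.univ.erase i, exA η (v i) (v k) =
      (∏ k ∈ Finset.univ.erase i, sinh (v i + v k) * sinh (v i - v k - η)) /
        ∏ k ∈ Finset.univ.erase i, (sinh (v i + v k + η) * sinh (v i - v k)) := by
    rw [← Finset.prod_div_distrib]
    exact Finset.prod_congr rfl fun k _ => by rw [exA, mul_comm (sinh (v i + v k))]
  rw [dressed, e, refA, y1, betheDenom]
  field_simp

/-- Under `x ↦ -x - η` the numerators of `A₋` turn into those of the companion. The arguments change
sign in pairs, so no sign survives; the extra `sinh (2 * v i)` comes from `refE`. -/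
theorem dressed_E_eq_y1 (i : Fin M) (hδ : sinh (δ + v i) ≠ 0) (hζ : sinh (ζ + v i) ≠ 0)
    (hv : ∀ k, k ≠ i → GenericPair η (v i) (v k)) :
    sinh (ζ' + v i + η) * sinh (δ' - v i - η) *
        dressed (exE η) (refE η δ ζ ξ) v (Finset.univ.erase i) (v i) =
      sinh (2 * v i) * y1 η δ ζ δ' ζ' ξ v i (-v i - η) / betheDenom η δ ζ v i := by
  have hp : ∏ k ∈ Finset.univ.erase i, (sinh (v i + v k + η) * sinh (v i - v k)) ≠ 0 :=
    Finset.prod_ne_zero_iff.2 fun k hk =>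
      mul_ne_zero (hv k (Finset.ne_of_mem_erase hk)).add_eta (hv k (Finset.ne_of_mem_erase hk)).sub
  have e : ∏ k ∈ Finset.univ.erase i, exE η (v i) (v k) =
      (∏ k ∈ Finset.univ.erase i, sinh (-v i - η + v k) * sinh (-v i - η - v k - η)) /
        ∏ k ∈ Finset.univ.erase i, (sinh (v i + v k + η) * sinh (v i - v k)) := by
    rw [← Finset.prod_div_distrib]
    refine Finset.prod_congr rfl fun k _ => ?_
    rw [exE, ← neg_mul_neg, ← Complex.sinh_neg, ← Complex.sinh_neg]
    congr 3 <;> ring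
  have e' : ∏ j, (sinh (v i + ξ j) * sinh (v i - ξ j)) =
      ∏ j, sinh (-v i - η + ξ j + η) * sinh (-v i - η - ξ j + η) := by
    refine Finset.prod_congr rfl fun j _ => ?_
    rw [mul_comm, ← neg_mul_neg, ← Complex.sinh_neg, ← Complex.sinh_neg]
    congr 2 <;> ring
  rw [dressed, e, refE, y1, betheDenom, e', show ζ + (-v i - η) = ζ - v i - η by ring,
    show δ - (-v i - η) = δ + v i + η by ring, show ζ' - (-v i - η) = ζ' + v i + η by ring,
    show δ' + (-v i - η) = δ' - v i - η by ring]
  field_simp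

theorem Lambda1_eq : Lambda1 η δ ζ δ' ζ' ξ v u =
    transferA η δ' ζ' u * dressed (exA η) (refA η δ ξ) v Finset.univ u +
    transferE η ζ' u * dressed (exE η) (refE η δ ζ ξ) v Finset.univ u := by
  have e1 : ∏ i, (sinh (u + v i) * sinh (u - v i - η)) / (sinh (u + v i + η) * sinh (u - v i)) =
      ∏ i, exA η u (v i) := Finset.prod_congr rfl fun k _ => by rw [exA, mul_comm (sinh (u + v k))]
  have e2 : ∏ i, (sinh (u + v i + 2 * η) * sinh (u - v i + η)) /
      (sinh (u + v i + η) * sinh (u - v i)) = ∏ i, exE η u (v i) :=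
    Finset.prod_congr rfl fun k _ => by rw [exE, mul_comm (sinh (u - v k + η))]
  rw [Lambda1, e1, e2, dressed, dressed, refA, refE, transferA, transferE]
  simp only [div_eq_mul_inv, mul_inv]
  ring

/-- The off-shell action of the transfer matrix on a Bethe state, for generic parameters. -/
theorem transferSOS_offShell (hθ : θ = δ - ζ) (hδζ : δ' - ζ' = θ - η * (N - 2 * M))
    (hgen : ∀ k : ℤ, |k| ≤ N + 2 * M + 5 → sinh (θ - η * k) ≠ 0)
    (hK : ∀ i, sinh (δ + v i) ≠ 0 ∧ sinh (ζ + v i) ≠ 0)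
    (hv : ∀ i j, i ≠ j → GenericPair η (v i) (v j)) (hδu : sinh (δ + u) ≠ 0)
    (hζu : sinh (ζ + u) ≠ 0) (hδ : sinh (δ' - u - η) ≠ 0) (hζ : sinh (ζ' - u - η) ≠ 0)
    (hu2 : sinh (2 * u + η) ≠ 0) (hu : ∀ i, GenericPair η u (v i)) :
    transferSOS η θ δ ζ δ' ζ' ξ u *ᵥ betheState η θ δ ζ ξ v =
      Lambda1 η δ ζ δ' ζ' ξ v u • betheState η θ δ ζ ξ v +
        ∑ i, (unwantedFactor η δ' ζ' u (v i) * sinh (2 * v i) / betheDenom η δ ζ v i *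
          (y1 η δ ζ δ' ζ' ξ v i (v i) - y1 η δ ζ δ' ζ' ξ v i (-v i - η))) •
            (Bminus η θ δ ζ ξ u *ᵥ betheVec η θ δ ζ ξ v (Finset.univ.erase i)) := by
  have hs : ∀ j : ℤ, |j| ≤ 5 → sinh (δ' - ζ' + η * j) ≠ 0 := fun j hj => by
    have h1 := abs_le.1 hj
    have := hgen (N - 2 * M - j) (abs_le.2 ⟨by omega, by omega⟩)
    convert this using 2
    rw [hδζ]; push_cast; ring
  have h0 : sinh (δ' - ζ') ≠ 0 := by simpa using hs 0 (by simp)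
  have h1 : sinh (δ' - ζ' + η) ≠ 0 := by simpa using hs 1 (by simp)
  have h2 : sinh (δ' - ζ' - η) ≠ 0 := by simpa [sub_eq_add_neg] using hs (-1) (by simp)
  have hmem : betheState η θ δ ζ ξ v ∈ weightSpace N (N - 2 * M) := by
    simpa [betheVec_univ] using
      betheVec_mem (η := η) (θ := θ) (δ := δ) (ζ := ζ) (ξ := ξ) (v := v) Finset.univ
  obtain ⟨hA, hE⟩ := offShell_doubleRow (ξ := ξ) hθ hgen hK hv hδu hζu hu (τ := δ' - ζ' - η)
    (by rw [hδζ])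
  -- The Bethe state has weight `N - 2M`, where the boundary constraint makes the dynamical
  -- parameter equal to `δ' - ζ'`; hence `τ = δ' - ζ' + η`.
  rw [transferSOS_mulVec, entry_one_one_mulVec (θ := θ) (τ := δ' - ζ' + η)
    (graded_doubleRow η θ δ ζ ξ u) hmem (by rw [hδζ]; push_cast; ring) h1 (by rwa [add_sub_cancel_right]) hu2,
    add_sub_cancel_right, smul_add, smul_smul, smul_smul, ← add_assoc, ← add_smul,
    transferA_eq h0 h1 hδ hζ hu2, transferE_eq h0 h1, hA, hE, Lambda1_eq, smul_add, smul_add,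
    add_add_add_comm, smul_smul, smul_smul, ← add_smul, Finset.smul_sum, Finset.smul_sum,
    ← Finset.sum_add_distrib]
  congr 1
  refine Finset.sum_congr rfl fun i _ => ?_
  rw [smul_smul, smul_smul, ← add_smul]
  congr 1
  have a1 := unwanted_A h2 hδ hζ (hu i)
  have a2 := unwanted_E h2 hδ hζ (hu i)
  have b1 := dressed_A_eq_y1 (ξ := ξ) (δ' := δ') (ζ' := ζ') i (hK i).1 (hK i).2
    fun k hk => hv i k hk.symm
  have b2 := dressed_E_eq_y1 (ξ := ξ) (δ' := δ') (ζ' := ζ') i (hK i).1 (hK i).2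
    fun k hk => hv i k hk.symm
  linear_combination
    dressed (exA η) (refA η δ ξ) v (Finset.univ.erase i) (v i) * a1 +
    dressed (exE η) (refE η δ ζ ξ) v (Finset.univ.erase i) (v i) * a2 +
    unwantedFactor η δ' ζ' u (v i) * sinh (2 * v i) * b1 - unwantedFactor η δ' ζ' u (v i) * b2

end Transfer

/-! ### Generic nonvanishing, periodicity and continuity in the parameters. -/

section Continuity

open Filter Topology

/-- The zeros of `sinh` are simple because `cosh² - sinh² = 1`. Along a nonconstant affine line the
value is therefore nonzero at all nearby points other than the base point. -/
theorem eventually_sinh_ne_zero {a b : ℂ} (h : b ≠ 0 ∨ sinh a ≠ 0) :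
    ∀ᶠ x in 𝓝[≠] (0 : ℂ), sinh (a + b * x) ≠ 0 := by
  by_cases ha : sinh a = 0
  · have hb := h.resolve_right (not_not.2 ha)
    have hc : cosh a ≠ 0 := fun hc => by
      have := Complex.cosh_sq_sub_sinh_sq a
      simp [ha, hc] at this
    have hd : HasDerivAt (fun x : ℂ => sinh (a + b * x)) (cosh (a + b * 0) * b) 0 := by
      simpa using (((hasDerivAt_id (0 : ℂ)).const_mul b).const_add a).csinh
    exact hd.eventually_ne (by simpa using ⟨hc, hb⟩)
  · have hc : ContinuousAt (fun x : ℂ => sinh (a + b * x)) 0 := by fun_prop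
    exact (hc.eventually_ne (by simpa using ha)).filter_mono nhdsWithin_le_nhds

theorem sinh_add_two_pi_mul_int (x : ℂ) (m : ℤ) :
    sinh (x + 2 * I * Real.pi * m) = sinh x := by
  have h : Complex.exp (2 * I * Real.pi * m) = 1 := by
    rw [Complex.exp_eq_one_iff]; exact ⟨m, by ring⟩
  rw [Complex.sinh, Complex.sinh, neg_add, Complex.exp_add, Complex.exp_add, Complex.exp_neg (_ * _),
    h, inv_one, mul_one, mul_one]

theorem sinh_sub_two_pi_mul_int (x : ℂ) (m : ℤ) :
    sinh (x - 2 * I * Real.pi * m) = sinh x := by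
  rw [← sinh_add_two_pi_mul_int _ m, sub_add_cancel]

variable {X : Type*} [TopologicalSpace X] {a : X}

theorem continuousAt_matrix {m n : Type*} {f : X → Matrix m n ℂ}
    (h : ∀ i j, ContinuousAt (fun x => f x i j) a) : ContinuousAt f a :=
  continuousAt_pi.2 fun i => continuousAt_pi.2 fun j => h i j

theorem continuousAt_matrix_apply {m n : Type*} {f : X → Matrix m n ℂ}
    (h : ContinuousAt f a) (i : m) (j : n) : ContinuousAt (fun x => f x i j) a :=
  continuousAt_pi.1 (continuousAt_pi.1 h i) j

theorem continuousAt_mulVec {m n : Type*} [Fintype n] {f : X → Matrix m n ℂ} {g : X → n → ℂ}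
    (hf : ContinuousAt f a) (hg : ContinuousAt g a) :
    ContinuousAt (fun x => f x *ᵥ g x) a := by
  refine continuousAt_pi.2 fun i => ?_
  simp only [Matrix.mulVec, dotProduct]
  exact tendsto_finsetSum _ fun j _ => (continuousAt_matrix_apply hf i j).mul (continuousAt_pi.1 hg j)

variable {η : ℂ} {θ δ ζ δ' ζ' u : X → ℂ}

theorem continuousAt_dynR (hu : ContinuousAt u a) (hθ : ContinuousAt θ a) (h : sinh (θ a) ≠ 0)
    (p q : Fin 2 × Fin 2) : ContinuousAt (fun x => dynR η (u x) (θ x) p q) a := by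
  obtain ⟨b, c⟩ := p
  obtain ⟨d, e⟩ := q
  simp only [dynR_apply, wDiag, wSwap]
  refine ContinuousAt.add ?_ ?_ <;> split_ifs <;> fun_prop (disch := assumption)

/-- The sum runs over the sites strictly to the right of `m`, at most `N - 1` of them. This is why
the strict bound `|k| < N` suffices for the operators to be defined and continuous. -/
theorem sinh_siteParam_ne_zero {N : ℕ} {t : ℂ}
    (h : ∀ k : ℤ, |k| < N → sinh (t - η * k) ≠ 0) (m : Fin N) (s : Config N) :
    sinh (siteParam η t m s) ≠ 0 := by
  have hk : |∑ j ∈ Finset.Ioi m, spin (s j)| < N := by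
    refine (Finset.abs_sum_le_sum_abs _ _).trans_lt ?_
    have : ∀ b : Fin 2, |spin b| = 1 := by decide
    simp only [this, Finset.sum_const, Fin.card_Ioi, nsmul_eq_mul, mul_one]
    omega
  simpa [siteParam, sz_eq_spin] using h _ hk

variable {N M : ℕ} {ξ : Fin N → ℂ} {v : X → Fin M → ℂ}

theorem continuousAt_siteR (hu : ContinuousAt u a) (hθ : ContinuousAt θ a)
    (h : ∀ k : ℤ, |k| < N → sinh (θ a - η * k) ≠ 0) (m : Fin N) :
    ContinuousAt (fun x => siteR η (θ x) m (u x)) a := by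
  refine continuousAt_matrix fun p q => ?_
  simp only [siteR, Matrix.of_apply]
  split_ifs
  · exact continuousAt_dynR hu (hθ.sub continuousAt_const) (sinh_siteParam_ne_zero h m q.2) _ _
  · exact continuousAt_const

theorem continuousAt_siteRhat (hu : ContinuousAt u a) (hθ : ContinuousAt θ a)
    (h : ∀ k : ℤ, |k| < N → sinh (θ a - η * k) ≠ 0) (m : Fin N) :
    ContinuousAt (fun x => siteRhat η (θ x) m (u x)) a := by
  refine continuousAt_matrix fun p q => ?_
  simp only [siteRhat, Matrix.of_apply]
  split_ifs
  · exact continuousAt_dynR hu (hθ.sub continuousAt_const) (sinh_siteParam_ne_zero h m q.2) _ _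
  · exact continuousAt_const

theorem continuousAt_onAux {K : X → Matrix (Fin 2) (Fin 2) ℂ} (hK : ContinuousAt K a) :
    ContinuousAt (fun x => onAux (N := N) (K x)) a := by
  refine continuousAt_matrix fun p q => ?_
  simp only [onAux, Matrix.kroneckerMap_apply]
  exact (continuousAt_matrix_apply hK _ _).mul continuousAt_const

theorem continuousAt_Kminus (hu : ContinuousAt u a) (hδ : ContinuousAt δ a)
    (hζ : ContinuousAt ζ a) (h1 : sinh (δ a + u a) ≠ 0) (h2 : sinh (ζ a + u a) ≠ 0) :
    ContinuousAt (fun x => Kminus (δ x) (ζ x) (u x)) a := by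
  refine continuousAt_matrix fun i j => ?_
  fin_cases i <;> fin_cases j <;> simp [Kminus] <;> fun_prop (disch := assumption)

theorem continuousAt_KplusTilde (hu : ContinuousAt u a) (hδ : ContinuousAt δ' a)
    (hζ : ContinuousAt ζ' a) (h0 : sinh (δ' a - ζ' a) ≠ 0) (h1 : sinh (δ' a - u a - η) ≠ 0)
    (h2 : sinh (ζ' a - u a - η) ≠ 0) :
    ContinuousAt (fun x => KplusTilde η (δ' x) (ζ' x) (u x)) a := by
  refine ContinuousAt.mul (continuousAt_matrix fun i j => ?_) (continuousAt_Kminus (by fun_prop)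
    hδ hζ (by convert h1 using 2; ring) (by convert h2 using 2; ring))
  fin_cases i <;> fin_cases j <;> simp [sz] <;> fun_prop (disch := assumption)

theorem continuousAt_doubleRow (hθ : ContinuousAt θ a) (hu : ContinuousAt u a)
    (hδ : ContinuousAt δ a) (hζ : ContinuousAt ζ a)
    (h : ∀ k : ℤ, |k| < N → sinh (θ a - η * k) ≠ 0) (h1 : sinh (δ a + u a) ≠ 0)
    (h2 : sinh (ζ a + u a) ≠ 0) :
    ContinuousAt (fun x => doubleRow η (θ x) (δ x) (ζ x) ξ (u x)) a := by
  refine ContinuousAt.mul (ContinuousAt.mul ?_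
    (continuousAt_onAux (continuousAt_Kminus hu hδ hζ h1 h2))) ?_
  · simp only [monodromy, List.ofFn_eq_map]
    exact tendsto_list_prod _ fun m _ => continuousAt_siteR (by fun_prop) hθ h m
  · simp only [monodromyHat, List.ofFn_eq_map, ← List.map_reverse]
    exact tendsto_list_prod _ fun m _ => continuousAt_siteRhat (by fun_prop) hθ h m

theorem continuousAt_Bminus (hθ : ContinuousAt θ a) (hu : ContinuousAt u a)
    (hδ : ContinuousAt δ a) (hζ : ContinuousAt ζ a)
    (h : ∀ k : ℤ, |k| < N → sinh (θ a - η * k) ≠ 0) (h1 : sinh (δ a + u a) ≠ 0)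
    (h2 : sinh (ζ a + u a) ≠ 0) :
    ContinuousAt (fun x => Bminus η (θ x) (δ x) (ζ x) ξ (u x)) a :=
  continuousAt_matrix fun _ _ =>
    continuousAt_matrix_apply (continuousAt_doubleRow hθ hu hδ hζ h h1 h2) _ _

theorem continuousAt_transferSOS (hθ : ContinuousAt θ a) (hu : ContinuousAt u a)
    (hδ : ContinuousAt δ a) (hζ : ContinuousAt ζ a) (hδ' : ContinuousAt δ' a)
    (hζ' : ContinuousAt ζ' a)
    (h : ∀ k : ℤ, |k| < N → sinh (θ a - η * k) ≠ 0) (h1 : sinh (δ a + u a) ≠ 0)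
    (h2 : sinh (ζ a + u a) ≠ 0) (h0 : sinh (δ' a - ζ' a) ≠ 0) (h3 : sinh (δ' a - u a - η) ≠ 0)
    (h4 : sinh (ζ' a - u a - η) ≠ 0) :
    ContinuousAt (fun x => transferSOS η (θ x) (δ x) (ζ x) (δ' x) (ζ' x) ξ (u x)) a := by
  have := (continuousAt_onAux (N := N) (continuousAt_KplusTilde hu hδ' hζ' h0 h3 h4)).mul
    (continuousAt_doubleRow (ξ := ξ) hθ hu hδ hζ h h1 h2)
  refine continuousAt_matrix fun p q => ?_
  simp only [transferSOS, traceAux, Matrix.sum_apply]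
  exact tendsto_finsetSum _ fun b _ => continuousAt_matrix_apply this _ _

theorem continuousAt_betheVec (hθ : ContinuousAt θ a) (hδ : ContinuousAt δ a)
    (hζ : ContinuousAt ζ a) (hv : ContinuousAt v a)
    (h : ∀ k : ℤ, |k| < N → sinh (θ a - η * k) ≠ 0)
    (hK : ∀ i, sinh (δ a + v a i) ≠ 0 ∧ sinh (ζ a + v a i) ≠ 0) (S : Finset (Fin M)) :
    ContinuousAt (fun x => betheVec η (θ x) (δ x) (ζ x) ξ (v x) S) a :=
  continuousAt_mulVec (tendsto_list_prod _ fun i _ => continuousAt_Bminus hθ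
    (continuousAt_pi.1 hv i) hδ hζ h (hK i).1 (hK i).2) continuousAt_const

theorem continuousAt_Lambda1 (hu : ContinuousAt u a) (hδ : ContinuousAt δ a)
    (hζ : ContinuousAt ζ a) (hδ' : ContinuousAt δ' a) (hζ' : ContinuousAt ζ' a)
    (hv : ContinuousAt v a) (h1 : sinh (δ a + u a) ≠ 0)
    (h2 : sinh (ζ a + u a) ≠ 0) (h3 : sinh (δ' a - u a - η) ≠ 0)
    (h4 : sinh (ζ' a - u a - η) ≠ 0) (h5 : sinh (2 * u a + η) ≠ 0)
    (h6 : ∀ i, sinh (u a - v a i) ≠ 0 ∧ sinh (u a + v a i + η) ≠ 0) :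
    ContinuousAt (fun x => Lambda1 η (δ x) (ζ x) (δ' x) (ζ' x) ξ (v x) (u x)) a := by
  have hv' := continuousAt_pi.1 hv
  have h7 : ∀ i, sinh (u a + v a i + η) * sinh (u a - v a i) ≠ 0 := fun i =>
    mul_ne_zero (h6 i).2 (h6 i).1
  refine ContinuousAt.add (ContinuousAt.mul (ContinuousAt.mul ?_ ?_) ?_)
    (ContinuousAt.mul (ContinuousAt.mul ?_ ?_) ?_)
  · exact ContinuousAt.div₀ (by fun_prop) (by fun_prop)
      (mul_ne_zero (mul_ne_zero (mul_ne_zero h4 h3) h1) h5)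
  · exact tendsto_finsetProd _ fun i _ => by
      have := hv' i
      exact ContinuousAt.div₀ (by fun_prop) (by fun_prop) (h7 i)
  · exact tendsto_finsetProd _ fun j _ => ContinuousAt.mul (by fun_prop) (by fun_prop)
  · exact ContinuousAt.div₀ (by fun_prop) (by fun_prop)
      (mul_ne_zero (mul_ne_zero (mul_ne_zero h4 h1) h2) h5)
  · exact tendsto_finsetProd _ fun i _ => by
      have := hv' i
      exact ContinuousAt.div₀ (by fun_prop) (by fun_prop) (h7 i)
  · exact tendsto_finsetProd _ fun j _ => ContinuousAt.mul (by fun_prop) (by fun_prop)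

theorem continuousAt_unwantedFactor {w : X → ℂ} (hu : ContinuousAt u a) (hw : ContinuousAt w a)
    (hδ' : ContinuousAt δ' a) (hζ' : ContinuousAt ζ' a) (hw2 : sinh (2 * w a + η) ≠ 0)
    (h3 : sinh (δ' a - u a - η) ≠ 0) (h4 : sinh (ζ' a - u a - η) ≠ 0)
    (h6 : sinh (u a - w a) ≠ 0 ∧ sinh (u a + w a + η) ≠ 0) :
    ContinuousAt (fun x => unwantedFactor η (δ' x) (ζ' x) (u x) (w x)) a :=
  ContinuousAt.div₀ (by fun_prop) (by fun_prop)
    (mul_ne_zero (mul_ne_zero (mul_ne_zero (mul_ne_zero hw2 h4) h3) h6.1) h6.2)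

theorem continuousAt_betheDenom (hδ : ContinuousAt δ a) (hζ : ContinuousAt ζ a)
    (hv : ContinuousAt v a) (i : Fin M) :
    ContinuousAt (fun x => betheDenom η (δ x) (ζ x) (v x) i) a := by
  have hv' := continuousAt_pi.1 hv
  have hi := hv' i
  refine ContinuousAt.mul (by fun_prop) (tendsto_finsetProd _ fun k _ => ?_)
  have := hv' k
  exact ContinuousAt.mul (by fun_prop) (by fun_prop)

theorem continuousAt_y1 {w : X → ℂ} (hδ : ContinuousAt δ a) (hζ : ContinuousAt ζ a)
    (hδ' : ContinuousAt δ' a) (hζ' : ContinuousAt ζ' a) (hv : ContinuousAt v a)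
    (hw : ContinuousAt w a) (i : Fin M) :
    ContinuousAt (fun x => y1 η (δ x) (ζ x) (δ' x) (ζ' x) ξ (v x) i (w x)) a := by
  have hv' := continuousAt_pi.1 hv
  refine ContinuousAt.mul (ContinuousAt.mul (by fun_prop) (tendsto_finsetProd _ fun k _ => ?_))
    (tendsto_finsetProd _ fun j _ => ?_)
  · have := hv' k
    exact ContinuousAt.mul (by fun_prop) (by fun_prop)
  · exact ContinuousAt.mul (by fun_prop) (by fun_prop)

end Continuity

/-! ### Removal of the genericity conditions. -/

section Eigenvector

open Filter Topology

variable {N M : ℕ} {η θ δ ζ δ' ζ' u : ℂ} {ξ : Fin N → ℂ} {v : Fin M → ℂ}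

/-- Bethe states whose roots satisfy the Bethe equations are eigenvectors of the transfer matrix. -/
theorem transferSOS_mulVec_betheState (hθ : θ = δ - ζ) (hδζ : δ' - ζ' = θ - η * (N - 2 * M))
    (h0 : sinh (δ' - ζ') ≠ 0)
    (hheight : ∀ k : ℤ, |k| < N → sinh (θ - η * k) ≠ 0)
    (hK : ∀ i, sinh (δ + v i) ≠ 0 ∧ sinh (ζ + v i) ≠ 0)
    (hne : ∀ i k, i ≠ k → sinh (v i - v k) ≠ 0) (hsymm : ∀ i k, sinh (v i + v k + η) ≠ 0)
    (hδu : sinh (δ + u) ≠ 0) (hζu : sinh (ζ + u) ≠ 0) (hδ : sinh (δ' - u - η) ≠ 0)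
    (hζ : sinh (ζ' - u - η) ≠ 0) (hu2 : sinh (2 * u + η) ≠ 0)
    (hu : ∀ i, sinh (u - v i) ≠ 0 ∧ sinh (u + v i + η) ≠ 0)
    (hBethe : ∀ i, y1 η δ ζ δ' ζ' ξ v i (v i) = y1 η δ ζ δ' ζ' ξ v i (-v i - η)) :
    transferSOS η θ δ ζ δ' ζ' ξ u *ᵥ betheState η θ δ ζ ξ v =
      Lambda1 η δ ζ δ' ζ' ξ v u • betheState η θ δ ζ ξ v := by
  -- The parameters `δ`, `δ'`, `θ` and `u` move with slope 1 while `ζ` and `ζ'` stay fixed, so both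
  -- boundary relations persist. The slopes `i + 2` of the roots make the relevant combinations move
  -- with slopes such as `±(i + 1)`, `i + 3`, `i + j + 4` and `i - j` for `i ≠ j`, none of them
  -- zero.
  let w : ℂ → Fin M → ℂ := fun x i => v i + (i + 2) * x
  have hw0 : w 0 = v := by ext i; simp [w]
  have hw : ContinuousAt w 0 := continuousAt_pi.2 fun i => by fun_prop
  have hwi : ∀ i, ContinuousAt (fun x => w x i) 0 := continuousAt_pi.1 hw
  have cθ : ContinuousAt (fun x : ℂ => θ + x) 0 := by fun_prop
  have cδ : ContinuousAt (fun x : ℂ => δ + x) 0 := by fun_prop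
  have cδ' : ContinuousAt (fun x : ℂ => δ' + x) 0 := by fun_prop
  have cu : ContinuousAt (fun x : ℂ => u + x) 0 := by fun_prop
  have cζ : ContinuousAt (fun _ : ℂ => ζ) 0 := continuousAt_const
  have cζ' : ContinuousAt (fun _ : ℂ => ζ') 0 := continuousAt_const
  have hden : ∀ i, betheDenom η δ ζ v i ≠ 0 := fun i =>
    mul_ne_zero (mul_ne_zero (hK i).1 (hK i).2) (Finset.prod_ne_zero_iff.2 fun k hk =>
      mul_ne_zero (hsymm i k) (hne i k (Finset.ne_of_mem_erase hk).symm))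
  have cψ := fun S => continuousAt_betheVec (η := η) (ξ := ξ) cθ cδ cζ hw (by simpa using hheight)
    (by simpa [hw0] using hK) S
  have cL := continuousAt_mulVec (continuousAt_transferSOS (η := η) (ξ := ξ) cθ cu cδ cζ cδ' cζ'
    (by simpa using hheight) (by simpa using hδu) (by simpa using hζu) (by simpa using h0)
    (by simpa using hδ) (by simpa using hζ)) (cψ Finset.univ)
  have cΛ := (continuousAt_Lambda1 (η := η) (ξ := ξ) cu cδ cζ cδ' cζ' hw (by simpa using hδu)
    (by simpa using hζu) (by simpa using hδ) (by simpa using hζ) (by simpa using hu2)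
    (by simpa [hw0] using hu)).smul (cψ Finset.univ)
  -- The denominators of the unwanted terms are nonzero already at `x = 0` under the stated
  -- hypotheses, so these terms converge; the Bethe equations make their limits zero.
  have cS : ∀ i, ContinuousAt (fun x : ℂ =>
      (unwantedFactor η (δ' + x) ζ' (u + x) (w x i) * sinh (2 * w x i) /
        betheDenom η (δ + x) ζ (w x) i *
          (y1 η (δ + x) ζ (δ' + x) ζ' ξ (w x) i (w x i) -
            y1 η (δ + x) ζ (δ' + x) ζ' ξ (w x) i (-w x i - η))) •
        (Bminus η (θ + x) (δ + x) ζ ξ (u + x) *ᵥ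
          betheVec η (θ + x) (δ + x) ζ ξ (w x) (Finset.univ.erase i))) 0 := fun i => by
    have hi := hwi i
    have h2 : sinh (2 * v i + η) ≠ 0 := by simpa [two_mul] using hsymm i i
    refine ContinuousAt.smul (ContinuousAt.mul (ContinuousAt.div₀ (ContinuousAt.mul ?_
      (by fun_prop)) (continuousAt_betheDenom cδ cζ hw i) ?_) (ContinuousAt.sub ?_ ?_))
      (continuousAt_mulVec ?_ (cψ _))
    · exact continuousAt_unwantedFactor cu hi cδ' cζ' (by simpa [hw0] using h2) (by simpa using hδ)
        (by simpa using hζ) (by simpa [hw0] using hu i)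
    · simpa [hw0] using hden i
    · exact continuousAt_y1 cδ cζ cδ' cζ' hw hi i
    · exact continuousAt_y1 cδ cζ cδ' cζ' hw (by fun_prop) i
    · exact continuousAt_Bminus cθ cu cδ cζ (by simpa using hheight) (by simpa using hδu)
        (by simpa using hζu)
  have key := tendsto_nhds_unique_of_eventuallyEq (cL.mono_left nhdsWithin_le_nhds)
    ((cΛ.add (tendsto_finsetSum Finset.univ fun i _ => cS i)).mono_left
      (nhdsWithin_le_nhds (s := {0}ᶜ))) ?_
  · simpa [hw0, hBethe, betheVec_univ] using key
  have n1 : ∀ i : Fin M, (i : ℂ) + 1 ≠ 0 := fun i => by exact_mod_cast Nat.succ_ne_zero i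
  have n2 : ∀ i : Fin M, (i : ℂ) + 2 ≠ 0 := fun i => by exact_mod_cast Nat.succ_ne_zero (i + 1)
  have n3 : ∀ i : Fin M, (i : ℂ) + 3 ≠ 0 := fun i => by exact_mod_cast Nat.succ_ne_zero (i + 2)
  have n4 : ∀ i j : Fin M, (i : ℂ) + j + 4 ≠ 0 := fun i j => by
    exact_mod_cast Nat.succ_ne_zero (i + j + 3)
  have n5 : ∀ i j : Fin M, i ≠ j → (i : ℂ) - j ≠ 0 := fun i j hij => by
    rw [sub_ne_zero]; exact_mod_cast Fin.val_ne_of_ne hij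
  have ev : ∀ {b : ℂ} (f : ℂ → ℂ), b ≠ 0 ∨ sinh (f 0) ≠ 0 → (∀ x, f x = f 0 + b * x) →
      ∀ᶠ x in 𝓝[≠] (0 : ℂ), sinh (f x) ≠ 0 := fun f h hf => by
    have := eventually_sinh_ne_zero h
    simp only [← hf] at this
    exact this
  have e1 : ∀ᶠ x in 𝓝[≠] (0 : ℂ), ∀ k ∈ Finset.Icc (-(N + 2 * M + 5 : ℤ)) (N + 2 * M + 5),
      sinh (θ + x - η * k) ≠ 0 := (eventually_all_finset _).2 fun k _ =>
    ev _ (Or.inl one_ne_zero) fun x => by ring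
  have e2 : ∀ᶠ x in 𝓝[≠] (0 : ℂ), ∀ i, sinh (δ + x + w x i) ≠ 0 := eventually_all.2 fun i =>
    ev _ (Or.inl (n3 i)) fun x => by simp only [w]; ring
  have e3 : ∀ᶠ x in 𝓝[≠] (0 : ℂ), ∀ i, sinh (ζ + w x i) ≠ 0 := eventually_all.2 fun i =>
    ev _ (Or.inl (n2 i)) fun x => by simp only [w]; ring
  have e4 : ∀ᶠ x in 𝓝[≠] (0 : ℂ), ∀ i, sinh (2 * w x i + η) ≠ 0 := eventually_all.2 fun i =>
    ev _ (Or.inl (mul_ne_zero two_ne_zero (n2 i))) fun x => by simp only [w]; ring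
  have e5 : ∀ᶠ x in 𝓝[≠] (0 : ℂ), ∀ i j, sinh (w x i + w x j + η) ≠ 0 ∧ sinh (w x i + w x j) ≠ 0 :=
    eventually_all.2 fun i => eventually_all.2 fun j =>
      (ev _ (Or.inl (n4 i j)) fun x => by simp only [w]; ring).and
        (ev _ (Or.inl (n4 i j)) fun x => by simp only [w]; ring)
  have e6 : ∀ᶠ x in 𝓝[≠] (0 : ℂ), ∀ i j, i ≠ j →
      sinh (w x i - w x j) ≠ 0 ∧ sinh (w x i - w x j + η) ≠ 0 :=
    eventually_all.2 fun i => eventually_all.2 fun j => eventually_imp_distrib_left.2 fun hij =>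
      (ev _ (Or.inl (n5 i j hij)) fun x => by simp only [w]; ring).and
        (ev _ (Or.inl (n5 i j hij)) fun x => by simp only [w]; ring)
  have e7 : ∀ᶠ x in 𝓝[≠] (0 : ℂ), ∀ i, sinh (u + x + w x i + η) ≠ 0 ∧ sinh (u + x + w x i) ≠ 0 :=
    eventually_all.2 fun i =>
      (ev _ (Or.inl (n3 i)) fun x => by simp only [w]; ring).and
        (ev _ (Or.inl (n3 i)) fun x => by simp only [w]; ring)
  have e8 : ∀ᶠ x in 𝓝[≠] (0 : ℂ), ∀ i,
      sinh (u + x - w x i) ≠ 0 ∧ sinh (u + x - w x i + η) ≠ 0 :=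
    eventually_all.2 fun i =>
      (ev _ (Or.inl (neg_ne_zero.2 (n1 i))) fun x => by simp only [w]; ring).and
        (ev _ (Or.inl (neg_ne_zero.2 (n1 i))) fun x => by simp only [w]; ring)
  have e9 : ∀ᶠ x in 𝓝[≠] (0 : ℂ), sinh (δ + x + (u + x)) ≠ 0 ∧ sinh (ζ + (u + x)) ≠ 0 :=
    (ev _ (Or.inl two_ne_zero) fun x => by ring).and (ev _ (Or.inl one_ne_zero) fun x => by ring)
  have e10 : ∀ᶠ x in 𝓝[≠] (0 : ℂ), sinh (δ' + x - (u + x) - η) ≠ 0 ∧ sinh (ζ' - (u + x) - η) ≠ 0 :=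
    -- Here `δ'` and `u` move together, so the first argument is constant along the line. Both
    -- arguments are handled by nonvanishing at the base point.
    (ev (b := 0) _ (Or.inr (by simpa using hδ)) fun x => by ring).and (ev (b := -1) _ (Or.inr (by simpa using hζ)) fun x => by ring)
  have e11 : ∀ᶠ x in 𝓝[≠] (0 : ℂ), sinh (2 * (u + x) + η) ≠ 0 :=
    ev _ (Or.inl two_ne_zero) fun x => by ring
  filter_upwards [e1, e2, e3, e4, e5, e6, e7, e8, e9, e10, e11]
    with x h1 h2 h3 h4 h5 h6 h7 h8 h9 h10 h11
  simp only [betheVec_univ]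
  exact transferSOS_offShell (by rw [hθ]; ring) (by linear_combination hδζ)
    (fun k hk => h1 k (Finset.mem_Icc.2 (abs_le.1 hk))) (fun i => ⟨h2 i, h3 i⟩)
    (fun i j hij => ⟨h4 i, h4 j, (h5 i j).1, (h5 i j).2, (h6 i j hij).1, (h6 i j hij).2⟩)
    h9.1 h9.2 h10.1 h10.2 h11
    (fun i => ⟨h11, h4 i, (h7 i).1, (h7 i).2, (h8 i).1, (h8 i).2⟩)

/-- Together with the two analogous lemmas for `Λ₁` and `y₁`, this allows the integer `m` of the
boundary constraint to be absorbed into `ζ'`. -/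
theorem KplusTilde_add_two_pi (m : ℤ) :
    KplusTilde η δ' (ζ' + 2 * I * Real.pi * m) u = KplusTilde η δ' ζ' u := by
  have h0 : δ' - (ζ' + 2 * I * Real.pi * m) = δ' - ζ' - 2 * I * Real.pi * m := by ring
  have h2 : ∀ x, ζ' + 2 * I * Real.pi * m - x = ζ' - x + 2 * I * Real.pi * m := fun x => by ring
  have h3 : ∀ x, ζ' + 2 * I * Real.pi * m + x = ζ' + x + 2 * I * Real.pi * m := fun x => by ring
  simp only [KplusTilde, Kminus, h0, h2, h3,
    sub_right_comm _ (2 * I * Real.pi * m), sinh_add_two_pi_mul_int,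
    sinh_sub_two_pi_mul_int]

theorem transferSOS_add_two_pi (m : ℤ) :
    transferSOS η θ δ ζ δ' (ζ' + 2 * I * Real.pi * m) ξ u = transferSOS η θ δ ζ δ' ζ' ξ u := by
  simp only [transferSOS, KplusTilde_add_two_pi]

theorem Lambda1_add_two_pi (m : ℤ) :
    Lambda1 η δ ζ δ' (ζ' + 2 * I * Real.pi * m) ξ v u = Lambda1 η δ ζ δ' ζ' ξ v u := by
  have h2 : ∀ x, ζ' + 2 * I * Real.pi * m - x = ζ' - x + 2 * I * Real.pi * m := fun x => by ring
  have h3 : ∀ x, ζ' + 2 * I * Real.pi * m + x = ζ' + x + 2 * I * Real.pi * m := fun x => by ring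
  simp only [Lambda1, h2, h3, add_sub_right_comm _ (2 * I * Real.pi * m),
    add_right_comm _ (2 * I * Real.pi * m), sinh_add_two_pi_mul_int]

theorem y1_add_two_pi (m : ℤ) (i : Fin M) (x : ℂ) :
    y1 η δ ζ δ' (ζ' + 2 * I * Real.pi * m) ξ v i x = y1 η δ ζ δ' ζ' ξ v i x := by
  simp only [y1, add_sub_right_comm _ (2 * I * Real.pi * m), sinh_add_two_pi_mul_int]

end Eigenvector

end SOS

end

theorem mainTheorem2 (N M : ℕ) (s n m : ℤ)
    (η δ ζ δ' ζ' τ τ' θ : ℂ) (ξ : Fin N → ℂ) (v : Fin M → ℂ)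
    -- the dynamical parameter and the boundary constraints
    (hθ : θ = δ - ζ)
    (_hτ : τ' = τ + η + Complex.I * Real.pi * n)
    (hδζ : δ' - ζ' = δ - ζ - η * s + 2 * Complex.I * Real.pi * m)
    -- `s` has the parity of `N`, `|s| < N`, and `M = (N - s) / 2`
    (hs : |s| < N) (hM : 2 * (M : ℤ) = N - s)
    -- all the dynamical `R`-matrices are defined
    (hheight : ∀ k : ℤ, |k| < N → Complex.sinh (θ - η * k) ≠ 0)
    -- the operators `B₋(v i; θ)` are defined
    (hvK : ∀ i, Complex.sinh (δ + v i) ≠ 0 ∧ Complex.sinh (ζ + v i) ≠ 0)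
    -- the Bethe roots are distinct, up to the symmetries `x ↦ x + iπ` and `x ↦ -x - η`,
    -- and none of them is a fixed point of the latter
    (hvne : ∀ i k, i ≠ k → Complex.sinh (v i - v k) ≠ 0)
    (hvsymm : ∀ i k, Complex.sinh (v i + v k + η) ≠ 0)
    -- the Bethe equations
    (hBethe : ∀ i, SOS.y1 η δ ζ δ' ζ' ξ v i (v i) = SOS.y1 η δ ζ δ' ζ' ξ v i (-v i - η)) :
    -- for every `u` at which the transfer matrix and the eigenvalue are defined
    ∀ u : ℂ, Complex.sinh (δ + u) ≠ 0 → Complex.sinh (ζ + u) ≠ 0 →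
      Complex.sinh (δ' - u - η) ≠ 0 → Complex.sinh (ζ' - u - η) ≠ 0 →
      Complex.sinh (2 * u + η) ≠ 0 →
      (∀ i, Complex.sinh (u - v i) ≠ 0 ∧ Complex.sinh (u + v i + η) ≠ 0) →
      SOS.transferSOS η θ δ ζ δ' ζ' ξ u *ᵥ SOS.betheState η θ δ ζ ξ v
          = SOS.Lambda1 η δ ζ δ' ζ' ξ v u • SOS.betheState η θ δ ζ ξ v
        ∧ (SOS.betheState η θ δ ζ ξ v ≠ 0 →
            Module.End.HasEigenvector (Matrix.toLin' (SOS.transferSOS η θ δ ζ δ' ζ' ξ u))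
              (SOS.Lambda1 η δ ζ δ' ζ' ξ v u) (SOS.betheState η θ δ ζ ξ v)) := by
  intro u hδu hζu hδ hζ hu2 hu
  have hs' : (s : ℂ) = N - 2 * M := by
    have : s = N - 2 * M := by omega
    rw [this]; push_cast; ring
  have hc : δ' - (ζ' + 2 * Complex.I * Real.pi * m) = θ - η * s := by
    rw [hθ]; linear_combination hδζ
  -- The point `ζ' + 2πi m` satisfies the constraint without the period. Nonvanishing of the
  -- denominator of `K̃₊` there is the height condition at `k = s`, which is available because `|s|
  -- < N`.
  have key := SOS.transferSOS_mulVec_betheState (ξ := ξ) (v := v) (u := u) hθ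
    (hc.trans (by rw [hs'])) (hc ▸ hheight s hs) hheight hvK hvne hvsymm hδu hζu hδ
    (by rwa [add_sub_right_comm, add_sub_right_comm, SOS.sinh_add_two_pi_mul_int]) hu2 hu
    (fun i => by simpa only [SOS.y1_add_two_pi] using hBethe i)
  rw [SOS.transferSOS_add_two_pi, SOS.Lambda1_add_two_pi] at key
  exact ⟨key, fun hψ => ⟨Module.End.mem_eigenspace_iff.2 (by rwa [Matrix.toLin'_apply]), hψ⟩⟩
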